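/- **Setting.** Let $0\le p\le 1$, $0\le D\le \tfrac12$ and $\rho>0$. The original response $X$ of a weak PUF is a binary word of length $m$ with i.i.d. Bernoulli$(p)$ bits; re-sampling it gives the noisy response $X\oplus e$, where the noise $e$ has i.i.d. Bernoulli$(D)$ bits and is independent of $X$. Let $d$ be the Hamming distance, $H(D)=-D\log_2 D-(1-D)\log_2(1-D)$, $H_\alpha(p)=\frac1{1-\alpha}\log_2\left(p^\alpha+(1-p)^\alpha\right)$, and $$\rho E(D,p)=\max\left(\rho H_{\frac1{1+\rho}}(p)-\rho H(D),\,0\right).$$ The attacker submits words $y_1,y_2,\dots$ one after the other until one is successful; the guesswork $G$ is the number of guesses used. In the distortion game, the order of the guesses is fixed without side information and $y$ is successful if $d(X,y)\le mD$; write $G^*(X,D)$ for the optimal guesswork. If the PUF is equipped with public helper data, it stores $w=h(X)$ and reconstructs the original response from a response $y$ as $r(y,w)$, where $r(x,h(x))=x$ for all $x$. The attacker knows $h$, $r$ and $w$, and $y$ is successful if $r(y,w)=X$; write $G^*(X\mid w)$ for the optimal guesswork. In both games, optimal means that the $\rho$-th moment is minimized over all orders of guesses (depending on $w$ in the second game).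 **Theorem.** The $\rho$-th moment of the guesswork of the noisy weak PUF grows exponentially in $m$ at rate $\rho E(D,p)$, in the following sense. 1. $\lim_{m\to\infty}\frac1m\log_2 \mathbb E\left[G^*(X,D)^\rho\right]=\rho E(D,p)$. 2. For every sequence of helper data $(h_m,r_m)$ that corrects every noise word of Hamming weight at most $mD$, $\limsup_{m\to\infty}\frac1m\log_2\mathbb E\left[G^*(X\mid w)^\rho\right]\le\rho E(D,p)$. 3. For every sequence of helper data such that $h_m$ takes at most $2^{m(H(D)+o(1))}$ values, $\liminf_{m\to\infty}\frac1m\log_2\mathbb E\left[G^*(X\mid w)^\rho\right]\ge\rho E(D,p)$. 4. There are binary linear codes $C_m$ of length $m$ with $\frac1m\dim C_m\to 1-H(D)$, and a choice of one representative in each coset of $C_m$ (with $0$ chosen in $C_m$), such that the following holds. Let the helper data be the coset $x+C_m$ of the original response $x$, and let $y$ be corrected by subtracting the chosen representative of the coset $(y-x)+C_m$. Then the probability that $X$ is reconstructed from $X\oplus e$ tends to $1$, and $\lim_{m\to\infty}\frac1m\log_2\mathbb E\left[G^*(X\mid w)^\rho\right]=\rho E(D,p)$. -/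

import Mathlib

open Filter Topology
open scoped ENNReal

namespace NoisyPUF

noncomputable section

/-- Binary words of length `m`; addition is bitwise exclusive or. -/
abbrev Word (m : ℕ) : Type := Fin m → ZMod 2

/-- Probability of the word `x` when its bits are i.i.d. Bernoulli(`p`). -/
def iidLaw (p : ℝ) {m : ℕ} (x : Word m) : ℝ :=
  ∏ i, if x i = 1 then p else 1 - p

/-- Binary Shannon entropy in bits. -/
def entropy (D : ℝ) : ℝ := -D * Real.logb 2 D - (1 - D) * Real.logb 2 (1 - D)

/-- Rényi entropy of order `α`, in bits, of the Bernoulli(`p`) distribution (`α ≠ 1`). -/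
def renyiEntropy (α p : ℝ) : ℝ := (1 / (1 - α)) * Real.logb 2 (p ^ α + (1 - p) ^ α)

/-- The exponent `ρ E(D, p) = max (ρ H_{1/(1+ρ)}(p) - ρ H(D)) 0`. -/
def exponent (ρ D p : ℝ) : ℝ :=
  max (ρ * renyiEntropy (1 / (1 + ρ)) p - ρ * entropy D) 0

/-- Number of guesses made by the guessing sequence `g 0, g 1, …` up to and including the first
one that lies in the set `A` of successful guesses (`∞` if there is none). -/
def guessCount {α : Type*} (g : ℕ → α) (A : Set α) : ℝ≥0∞ :=
  ⨅ k ∈ {k : ℕ | g k ∈ A}, ((k + 1 : ℕ) : ℝ≥0∞)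

/-- Optimal `ρ`-th moment of the number of guesses, when the secret `x` is i.i.d. Bernoulli(`p`),
the attacker sees the side information `side x` before fixing the order of the guesses, and the
successful guesses for `x` are the elements of `ok x`. -/
def optMoment (ρ p : ℝ) {m : ℕ} {W : Type*} (side : Word m → W)
    (ok : Word m → Set (Word m)) : ℝ≥0∞ :=
  ⨅ g : W → ℕ → Word m,
    ∑ x : Word m, ENNReal.ofReal (iidLaw p x) * guessCount (g (side x)) (ok x) ^ ρ

/-- Optimal `ρ`-th moment of the guesswork up to Hamming distortion `m D`,
without side information. -/
def distortionMoment (ρ p D : ℝ) (m : ℕ) : ℝ≥0∞ :=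
  optMoment (m := m) ρ p (fun _ => ()) (fun x => {y | (hammingDist x y : ℝ) ≤ m * D})

/-- The public helper data of a noisy weak PUF with an `m`-bit response: `sketch x` is stored when
the original response is `x`, and `recover y w` is the original response reconstructed from a
response `y` and the helper data `w`. In the absence of noise the reconstruction is correct. -/
structure HelperData (m : ℕ) (W : Type*) where
  sketch : Word m → W
  recover : Word m → W → Word m
  recover_self : ∀ x, recover x (sketch x) = x

namespace HelperData

variable {m : ℕ} {W : Type*}

/-- Optimal `ρ`-th moment of the guesswork of a weak PUF with helper data. The attacker knows the
helper data and guesses responses until one of them yields, together with the helper data, the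
original response. -/
def moment (S : HelperData m W) (ρ p : ℝ) : ℝ≥0∞ :=
  optMoment ρ p S.sketch (fun x => {y | S.recover y (S.sketch x) = x})

/-- Number of classes into which the helper data splits the set of responses. -/
def numClasses (S : HelperData m W) : ℕ := (Set.range S.sketch).ncard

/-- Every noise pattern of Hamming weight at most `m D` is corrected. -/
def CorrectsBall (S : HelperData m W) (D : ℝ) : Prop :=
  ∀ x e : Word m, (hammingNorm e : ℝ) ≤ m * D → S.recover (x + e) (S.sketch x) = x

open Classical in
/-- Probability that the original response is reconstructed from its noisy version, when the
original response is i.i.d. Bernoulli(`p`) and the additive noise is i.i.d. Bernoulli(`D`),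
independent of it. -/
def reliability (S : HelperData m W) (p D : ℝ) : ℝ :=
  ∑ x : Word m, ∑ e : Word m,
    if S.recover (x + e) (S.sketch x) = x then iidLaw p x * iidLaw D e else 0

/-- Helper data given by a binary linear code `C`: the coset of the response. A noisy response `y`
is corrected by subtracting the representative selected by `leader` in the coset of the noise. -/
def ofCode (C : Submodule (ZMod 2) (Word m)) (leader : Word m ⧸ C → Word m)
    (h0 : leader 0 = 0) : HelperData m (Word m ⧸ C) where
  sketch x := Submodule.Quotient.mk x
  recover y w := y - leader (Submodule.Quotient.mk y - w)
  recover_self x := by simp [h0]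

end HelperData

/-- Exponential growth rate `(1/m) log₂ M` of a moment `M`. -/
def growthRate (m : ℕ) (M : ℝ≥0∞) : ℝ := (1 / (m : ℝ)) * Real.logb 2 M.toReal

end

end NoisyPUF

/-! Two quantities govern every bound: the sum (∑ P(x)^(1/(1+ρ)))^(1+ρ), which equals 2^(m ρ
H_{1/(1+ρ)}(p)), and the number, about 2^(m H(D)), of secrets that one guess can settle.

Lower bounds. If the k-th guess, taken over all values of the side information, succeeds for at most
N secrets, then the reciprocals of the guess counts sum to at most N (m + 2), and a reverse Hölder
inequality bounds the moment below by 2^(m ρ H_{1/(1+ρ)}(p)) / (N (m + 2))^ρ (`le_optMoment`). In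
the distortion game N bounds the volume of a ball. With helper data N is the number of classes,
because a fixed guess recovers at most one response per class. The maximum with 0 appears because a
guess count is at least 1.

Upper bounds. P is constant on words of equal weight, and there are only m + 1 weights, so
strategies for the separate weight classes can be interleaved at polynomial cost. If a class T needs
about 1 + |T| 2^(-s) guesses, then `sum_iidLaw_mul_one_add_rpow_le` yields the exponent. For
distortion, s = m H(D): some ball contains T or meets it in nearly 2^(m H(D)) words (`exists_ball`),
and greedily chosen coordinate permutations of that ball cover T (`exists_guesses_of_ball`). Helper
data correcting the ball can only make guessing easier (`moment_le_distortionMoment`).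

For the codes, the parity check with r ≈ m H(D) rows is random. In ρ-th moment a coset meets T in
about 1 + |T| 2^(-r) words (`sum_card_rpow_le`), and a union bound controls the confusable errors.
Averaging gives one parity check with both properties and a small kernel (`exists_parityCheck`).
Taking r slightly above m H(D) makes decoding reliable without changing the exponent
(`exists_codes`). -/

namespace NoisyPUF

/-! ### The product Bernoulli law on words. -/

section Law

variable {m : ℕ}

theorem bit_eq_one_iff (a : ZMod 2) : a = 1 ↔ a ≠ 0 := by
  revert a; decide

theorem iidLaw_nonneg {p : ℝ} (hp : 0 ≤ p ∧ p ≤ 1) (x : Word m) : 0 ≤ iidLaw p x := by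
  refine Finset.prod_nonneg fun i _ => ?_
  split_ifs <;> linarith

theorem iidLaw_eq_pow (p : ℝ) (x : Word m) :
    iidLaw p x = p ^ hammingNorm x * (1 - p) ^ (m - hammingNorm x) := by
  have hcard : (Finset.univ.filter fun i => ¬ x i ≠ 0).card = m - hammingNorm x := by
    have h := Finset.card_filter_add_card_filter_not (s := (Finset.univ : Finset (Fin m)))
      (fun i => x i ≠ 0)
    rw [Finset.card_univ, Fintype.card_fin] at h
    unfold hammingNorm
    omega
  unfold iidLaw
  simp_rw [bit_eq_one_iff]
  rw [Finset.prod_ite, Finset.prod_const, Finset.prod_const, hcard]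
  rfl

theorem iidLaw_congr (p : ℝ) {x y : Word m} (h : hammingNorm x = hammingNorm y) :
    iidLaw p x = iidLaw p y := by
  rw [iidLaw_eq_pow, iidLaw_eq_pow, h]

theorem hammingNorm_le (x : Word m) : hammingNorm x ≤ m := by
  simpa using hammingNorm_le_card_fintype (x := x)

theorem sum_prod_bits (f : ZMod 2 → ℝ) :
    ∑ x : Word m, ∏ i, f (x i) = (f 0 + f 1) ^ m := by
  have h := Finset.sum_pow' (Finset.univ : Finset (ZMod 2)) f m
  have h2 : ∑ a : ZMod 2, f a = f 0 + f 1 := Fin.sum_univ_two f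
  rw [← h2, h]
  simp

theorem sum_iidLaw (p : ℝ) : ∑ x : Word m, iidLaw p x = 1 := by
  have := sum_prod_bits (m := m) fun a => if a = 1 then p else 1 - p
  simpa [iidLaw] using this

theorem sum_iidLaw_rpow {p : ℝ} (hp : 0 ≤ p ∧ p ≤ 1) (α : ℝ) :
    ∑ x : Word m, iidLaw p x ^ α = (p ^ α + (1 - p) ^ α) ^ m := by
  have := sum_prod_bits (m := m) fun a => (if a = 1 then p else 1 - p) ^ α
  simp only [zero_ne_one, if_false, if_true] at this
  rw [add_comm (p ^ α), ← this]
  refine Finset.sum_congr rfl fun x _ => ?_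
  unfold iidLaw
  rw [Real.finsetProd_rpow]
  intro i _
  split_ifs <;> linarith

theorem rpow_add_one_sub_rpow_pos {p : ℝ} (hp : 0 ≤ p ∧ p ≤ 1) (α : ℝ) :
    0 < p ^ α + (1 - p) ^ α := by
  rcases hp.1.eq_or_lt with h | h
  · subst h
    have := Real.rpow_nonneg (le_refl (0 : ℝ)) α
    simp only [sub_zero, Real.one_rpow]
    linarith
  · have h1 := Real.rpow_pos_of_pos h α
    have h2 := Real.rpow_nonneg (sub_nonneg.2 hp.2) α
    linarith

/-- The sum of the powers `P(x) ^ (1/(1+ρ))`, raised to the power `1+ρ`, expressed by the Rényi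
entropy. -/
theorem sum_iidLaw_rpow_rpow {p ρ : ℝ} (hp : 0 ≤ p ∧ p ≤ 1) (hρ : 0 < ρ) :
    (∑ x : Word m, iidLaw p x ^ (1 / (1 + ρ))) ^ (1 + ρ)
      = 2 ^ (m * (ρ * renyiEntropy (1 / (1 + ρ)) p)) := by
  have hpos := rpow_add_one_sub_rpow_pos hp (1 / (1 + ρ))
  rw [sum_iidLaw_rpow hp, renyiEntropy]
  set A := p ^ (1 / (1 + ρ)) + (1 - p) ^ (1 / (1 + ρ)) with hA
  have h1 : (m : ℝ) * (ρ * (1 / (1 - 1 / (1 + ρ)) * Real.logb 2 A))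
      = Real.logb 2 A * (m * (1 + ρ)) := by
    have : 1 - 1 / (1 + ρ) = ρ / (1 + ρ) := by field_simp; ring
    rw [this]
    field_simp
  rw [h1, Real.rpow_mul (by norm_num), Real.rpow_logb (by norm_num) (by norm_num) hpos,
    Real.rpow_mul hpos.le, Real.rpow_natCast]

end Law

/-! ### Guessing sequences and how to combine them. -/

section Guess

variable {α : Type*}

theorem guessCount_le {g : ℕ → α} {A : Set α} {k : ℕ} (h : g k ∈ A) :
    guessCount g A ≤ ((k + 1 : ℕ) : ℝ≥0∞) :=
  iInf₂_le (f := fun k (_ : k ∈ {k : ℕ | g k ∈ A}) => ((k + 1 : ℕ) : ℝ≥0∞)) k h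

theorem one_le_guessCount (g : ℕ → α) (A : Set α) : 1 ≤ guessCount g A :=
  le_iInf₂ fun k _ => by exact_mod_cast Nat.succ_le_succ (Nat.zero_le k)

theorem guessCount_eq_top {g : ℕ → α} {A : Set α} (h : ∀ k, g k ∉ A) : guessCount g A = ∞ := by
  simp [guessCount, h]

theorem exists_guessCount_eq {g : ℕ → α} {A : Set α} (h : ∃ k, g k ∈ A) :
    ∃ k, g k ∈ A ∧ guessCount g A = ((k + 1 : ℕ) : ℝ≥0∞) := by
  classical
  refine ⟨Nat.find h, Nat.find_spec h, le_antisymm (guessCount_le (Nat.find_spec h)) ?_⟩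
  refine le_iInf₂ fun k hk => ?_
  exact_mod_cast Nat.succ_le_succ (Nat.find_min' h hk)

theorem guessCount_mono {g : ℕ → α} {A B : Set α} (h : A ⊆ B) :
    guessCount g B ≤ guessCount g A :=
  le_iInf₂ fun _ hk => guessCount_le (h hk)

/-- Alternating between `M` guessing sequences costs a factor `M` with respect to each. -/
theorem exists_interleave {M : ℕ} (g : ℕ → ℕ → α) :
    ∃ f : ℕ → α, ∀ t < M, ∀ A, guessCount f A ≤ M * guessCount (g t) A := by
  refine ⟨fun k => g (k % M) (k / M), fun t ht A => ?_⟩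
  have hM : 0 < M := by omega
  by_cases h : ∃ k, g t k ∈ A
  · obtain ⟨k, hk, he⟩ := exists_guessCount_eq h
    rw [he]
    -- In the round-robin order, guess k of sequence t sits at position t + M k.
    refine (guessCount_le (k := t + M * k) ?_).trans ?_
    · simpa [Nat.add_mul_mod_self_left, Nat.mod_eq_of_lt ht, Nat.add_mul_div_left _ _ hM,
        Nat.div_eq_of_lt ht] using hk
    · have : t + M * k + 1 ≤ M * (k + 1) := by rw [Nat.mul_succ]; omega
      exact_mod_cast this
  · push Not at h
    rw [guessCount_eq_top h, ENNReal.mul_top (by exact_mod_cast hM.ne')]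
    exact le_top

theorem exists_enumeration [Inhabited α] (s : Finset α) :
    ∃ g : ℕ → α, ∀ A : Set α, ∀ x ∈ s, x ∈ A → guessCount g A ≤ s.card := by
  classical
  -- Past the end of the list the filler `default` is guessed; the bound only uses positions inside
  -- the list.
  refine ⟨fun k => s.toList.getD k default, fun A x hx hA => ?_⟩
  obtain ⟨k, hk, he⟩ := List.getElem_of_mem (Finset.mem_toList.2 hx)
  refine (guessCount_le (k := k) ?_).trans ?_
  · rw [List.getD_eq_getElem _ _ hk, he]; exact hA
  · rw [Finset.length_toList] at hk
    exact_mod_cast hk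

end Guess

/-! ### General properties of the optimal moment. -/

section Moment

variable {m : ℕ} {W : Type*} {ρ p : ℝ} {side : Word m → W} {ok : Word m → Set (Word m)}

theorem one_le_optMoment (hp : 0 ≤ p ∧ p ≤ 1) (hρ : 0 < ρ) : 1 ≤ optMoment ρ p side ok := by
  refine le_iInf fun g => ?_
  calc (1 : ℝ≥0∞) = ∑ x : Word m, ENNReal.ofReal (iidLaw p x) := by
        rw [← ENNReal.ofReal_sum_of_nonneg fun x _ => iidLaw_nonneg hp x, sum_iidLaw,
          ENNReal.ofReal_one]
    _ ≤ _ := by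
        refine Finset.sum_le_sum fun x _ => ?_
        refine le_mul_of_one_le_right (zero_le) ?_
        exact ENNReal.one_le_rpow (one_le_guessCount _ _) hρ

/-- A bound on the optimal moment from strategies with a known number of guesses. -/
theorem optMoment_le (hp : 0 ≤ p ∧ p ≤ 1) (hρ : 0 < ρ) (g : W → ℕ → Word m) (N : Word m → ℝ)
    (hN : ∀ x, 0 ≤ N x)
    (hg : ∀ x, guessCount (g (side x)) (ok x) ≤ ENNReal.ofReal (N x)) :
    optMoment ρ p side ok ≤ ENNReal.ofReal (∑ x : Word m, iidLaw p x * N x ^ ρ) := by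
  refine (iInf_le _ g).trans ?_
  rw [ENNReal.ofReal_sum_of_nonneg fun x _ =>
    mul_nonneg (iidLaw_nonneg hp x) (Real.rpow_nonneg (hN x) _)]
  refine Finset.sum_le_sum fun x _ => ?_
  rw [ENNReal.ofReal_mul (iidLaw_nonneg hp x), ← ENNReal.ofReal_rpow_of_nonneg (hN x) hρ.le]
  gcongr
  exact hg x

/-- An attacker with finer side information and larger success sets can replay every strategy of the
weaker attacker. -/
theorem optMoment_mono {W' : Type*} {side' : Word m → W'} {ok' : Word m → Set (Word m)}
    (hρ : 0 < ρ) (φ : W → W')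
    (hside : ∀ x, φ (side x) = side' x) (hok : ∀ x, ok' x ⊆ ok x) :
    optMoment ρ p side ok ≤ optMoment ρ p side' ok' := by
  refine le_iInf fun g => (iInf_le _ fun w => g (φ w)).trans ?_
  refine Finset.sum_le_sum fun x _ => ?_
  beta_reduce
  rw [hside]
  gcongr
  exact guessCount_mono (hok x)

theorem optMoment_ne_top (hρ : 0 < ρ) (hok : ∀ x, x ∈ ok x) :
    optMoment ρ p side ok ≠ ∞ := by
  obtain ⟨g, hg⟩ := exists_enumeration (Finset.univ : Finset (Word m))
  refine ne_top_of_le_ne_top ?_ (iInf_le _ fun _ => g)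
  refine ENNReal.sum_ne_top.2 fun x _ => ENNReal.mul_ne_top ENNReal.ofReal_ne_top ?_
  refine ENNReal.rpow_ne_top_of_nonneg hρ.le ?_
  exact ne_top_of_le_ne_top (ENNReal.natCast_ne_top _) (hg _ x (Finset.mem_univ x) (hok x))

end Moment

/-! ### Lower bound on guessing moments by a reverse Hölder inequality. -/

/-- If a function takes each value at most `N` times, the sum of its reciprocals grows at most
logarithmically. -/
theorem sum_inv_le_of_card_fiber_le {ι : Type*} (s : Finset ι) (κ : ι → ℕ) {N : ℝ}
    (hN : ∀ k, ((s.filter fun x => κ x = k).card : ℝ) ≤ N) {n : ℕ} (hn : 0 < n) :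
    ∑ x ∈ s, ((κ x : ℝ) + 1)⁻¹ ≤ N * (1 + Real.log n) + s.card / n := by
  have hN0 : 0 ≤ N := (Nat.cast_nonneg _).trans (hN 0)
  -- Values below n contribute at most N times a harmonic sum; each other term is at most 1/n.
  rw [← Finset.sum_filter_add_sum_filter_not s fun x => κ x < n]
  gcongr ?_ + ?_
  · rw [← Finset.sum_fiberwise_of_maps_to (t := Finset.range n) (g := κ)
      fun x hx => Finset.mem_range.2 (Finset.mem_filter.1 hx).2]
    calc _ ≤ ∑ k ∈ Finset.range n, N * ((k : ℝ) + 1)⁻¹ := by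
          refine Finset.sum_le_sum fun k _ => ?_
          rw [Finset.sum_congr rfl fun x hx => by rw [(Finset.mem_filter.1 hx).2],
            Finset.sum_const, nsmul_eq_mul]
          gcongr
          refine le_trans ?_ (hN k)
          gcongr
          exact Finset.filter_subset _ _
      _ = N * (harmonic n : ℝ) := by
          rw [← Finset.mul_sum, harmonic]
          push_cast
          rfl
      _ ≤ _ := by
          gcongr
          exact harmonic_le_one_add_log n
  · calc _ ≤ ∑ x ∈ s.filter (fun x => ¬ κ x < n), (n : ℝ)⁻¹ := by
          refine Finset.sum_le_sum fun x hx => ?_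
          have h : (n : ℝ) ≤ κ x := by exact_mod_cast not_lt.1 (Finset.mem_filter.1 hx).2
          have hn' : (0 : ℝ) < n := by exact_mod_cast hn
          exact inv_anti₀ hn' (by linarith)
      _ ≤ _ := by
          rw [Finset.sum_const, nsmul_eq_mul, div_eq_mul_inv]
          gcongr
          exact Finset.filter_subset _ _

/-- Reverse form of Hölder's inequality behind the lower bound on guessing moments. -/
theorem sum_rpow_rpow_le {ι : Type*} (s : Finset ι) {P G : ι → ℝ} {ρ : ℝ} (hρ : 0 < ρ)
    (hP : ∀ x ∈ s, 0 ≤ P x) (hG : ∀ x ∈ s, 0 < G x) :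
    (∑ x ∈ s, P x ^ (1 / (1 + ρ))) ^ (1 + ρ)
      ≤ (∑ x ∈ s, P x * G x ^ ρ) * (∑ x ∈ s, (G x)⁻¹) ^ ρ := by
  have h1 : 0 < 1 + ρ := by linarith
  have hpq : Real.HolderConjugate (1 + ρ) ((1 + ρ) / ρ) := by
    rw [Real.holderConjugate_iff]
    refine ⟨by linarith, ?_⟩
    field_simp
  have hA : 0 ≤ ∑ x ∈ s, P x * G x ^ ρ :=
    Finset.sum_nonneg fun x hx => mul_nonneg (hP x hx) (Real.rpow_nonneg (hG x hx).le _)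
  have hB : 0 ≤ ∑ x ∈ s, (G x)⁻¹ := Finset.sum_nonneg fun x hx => inv_nonneg.2 (hG x hx).le
  -- Hölder with exponents 1+ρ and (1+ρ)/ρ, for the factorization P^(1/(1+ρ)) = (P G^ρ)^(1/(1+ρ)) ·
  -- G^(-ρ/(1+ρ)).
  have key := Real.inner_le_Lp_mul_Lq_of_nonneg (s := s) hpq
    (f := fun x => (P x * G x ^ ρ) ^ (1 / (1 + ρ))) (g := fun x => (G x)⁻¹ ^ (ρ / (1 + ρ)))
    (fun x hx => Real.rpow_nonneg (mul_nonneg (hP x hx) (Real.rpow_nonneg (hG x hx).le _)) _)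
    (fun x hx => Real.rpow_nonneg (inv_nonneg.2 (hG x hx).le) _)
  have e1 : ∑ x ∈ s, ((P x * G x ^ ρ) ^ (1 / (1 + ρ))) ^ (1 + ρ) = ∑ x ∈ s, P x * G x ^ ρ := by
    refine Finset.sum_congr rfl fun x hx => ?_
    rw [← Real.rpow_mul (mul_nonneg (hP x hx) (Real.rpow_nonneg (hG x hx).le _)),
      one_div_mul_cancel h1.ne', Real.rpow_one]
  have e2 : ∑ x ∈ s, ((G x)⁻¹ ^ (ρ / (1 + ρ))) ^ ((1 + ρ) / ρ) = ∑ x ∈ s, (G x)⁻¹ := by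
    refine Finset.sum_congr rfl fun x hx => ?_
    rw [← Real.rpow_mul (inv_nonneg.2 (hG x hx).le)]
    have : ρ / (1 + ρ) * ((1 + ρ) / ρ) = 1 := by field_simp
    rw [this, Real.rpow_one]
  have e3 : ∑ x ∈ s, (P x * G x ^ ρ) ^ (1 / (1 + ρ)) * (G x)⁻¹ ^ (ρ / (1 + ρ))
      = ∑ x ∈ s, P x ^ (1 / (1 + ρ)) := by
    refine Finset.sum_congr rfl fun x hx => ?_
    have hg := hG x hx
    rw [Real.mul_rpow (hP x hx) (Real.rpow_nonneg hg.le _), ← Real.rpow_mul hg.le,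
      Real.inv_rpow hg.le, mul_one_div, mul_assoc, mul_inv_cancel₀ (Real.rpow_pos_of_pos hg _).ne',
      mul_one]
  rw [e1, e2, e3] at key
  have hS : 0 ≤ ∑ x ∈ s, P x ^ (1 / (1 + ρ)) :=
    Finset.sum_nonneg fun x hx => Real.rpow_nonneg (hP x hx) _
  refine (Real.rpow_le_rpow hS key h1.le).trans_eq ?_
  rw [Real.mul_rpow (Real.rpow_nonneg hA _) (Real.rpow_nonneg hB _), ← Real.rpow_mul hA,
    ← Real.rpow_mul hB, one_div_mul_cancel h1.ne', Real.rpow_one]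
  congr 2
  field_simp

/-- Lower bound on the optimal moment when every guess is successful for at most `N` secrets. -/
theorem le_optMoment {m : ℕ} {W : Type*} {ρ p : ℝ} {side : Word m → W}
    {ok : Word m → Set (Word m)} (hp : 0 ≤ p ∧ p ≤ 1) (hρ : 0 < ρ) {N : ℝ} (hN1 : 1 ≤ N)
    (hN : ∀ (g : W → ℕ → Word m) (k : ℕ), ({x | g (side x) k ∈ ok x}.ncard : ℝ) ≤ N) :
    ENNReal.ofReal (2 ^ (m * (ρ * renyiEntropy (1 / (1 + ρ)) p)) / (N * (m + 2)) ^ ρ)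
      ≤ optMoment ρ p side ok := by
  classical
  refine le_iInf fun g => ?_
  -- A word of probability 0 may never be hit at no cost (0 · ∞ = 0), so only the support counts;
  -- missing a word of the support makes the moment infinite.
  set s : Finset (Word m) := Finset.univ.filter fun x => 0 < iidLaw p x with hs
  by_cases hfin : ∀ x ∈ s, ∃ k, g (side x) k ∈ ok x
  swap
  · push Not at hfin
    obtain ⟨x, hx, hk⟩ := hfin
    have hpos : 0 < iidLaw p x := (Finset.mem_filter.1 hx).2
    refine le_top.trans_eq (Eq.symm ?_)
    refine ENNReal.sum_eq_top.2 ⟨x, Finset.mem_univ _, ?_⟩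
    rw [guessCount_eq_top hk, ENNReal.top_rpow_of_pos hρ,
      ENNReal.mul_top (ENNReal.ofReal_pos.2 hpos).ne']
  choose! κ hκ hκe using fun x hx => exists_guessCount_eq (hfin x hx)
  have hsum : ∑ x : Word m, ENNReal.ofReal (iidLaw p x) * guessCount (g (side x)) (ok x) ^ ρ
      = ENNReal.ofReal (∑ x ∈ s, iidLaw p x * ((κ x : ℝ) + 1) ^ ρ) := by
    rw [ENNReal.ofReal_sum_of_nonneg fun x _ => mul_nonneg (iidLaw_nonneg hp x) (by positivity),
      ← Finset.sum_subset (Finset.subset_univ s)]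
    · refine Finset.sum_congr rfl fun x hx => ?_
      rw [hκe x hx, ENNReal.ofReal_mul (iidLaw_nonneg hp x),
        ← ENNReal.ofReal_rpow_of_nonneg (by positivity) hρ.le]
      congr 2
      rw [← Nat.cast_add_one, ENNReal.ofReal_natCast]
    · intro x _ hx
      have : iidLaw p x ≤ 0 := by simpa [hs] using hx
      rw [ENNReal.ofReal_of_nonpos this, zero_mul]
  rw [hsum]
  refine ENNReal.ofReal_le_ofReal ?_
  have hinv : ∑ x ∈ s, ((κ x : ℝ) + 1)⁻¹ ≤ N * (m + 2) := by
    have hcard : ∀ k, ((s.filter fun x => κ x = k).card : ℝ) ≤ N := by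
      intro k
      refine le_trans ?_ (hN g k)
      rw [← Set.ncard_coe_finset]
      gcongr
      · exact Set.toFinite _
      · intro x hx
        obtain ⟨h1, h2⟩ := Finset.mem_filter.1 (Finset.mem_coe.1 hx)
        subst h2
        exact hκ x h1
    -- The cutoff 2^m bounds the tail by 1 and the logarithm by m, so N (1 + m) + 1 ≤ N (m + 2)
    -- suffices.
    refine (sum_inv_le_of_card_fiber_le s κ hcard (n := 2 ^ m) (by positivity)).trans ?_
    have h1 : Real.log ((2 ^ m : ℕ) : ℝ) ≤ m := by
      push_cast
      rw [Real.log_pow]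
      have : Real.log 2 ≤ 1 := by linarith [Real.log_two_lt_d9]
      nlinarith [(Nat.cast_nonneg m : (0 : ℝ) ≤ m)]
    have h2 : (s.card : ℝ) / ((2 ^ m : ℕ) : ℝ) ≤ 1 := by
      rw [div_le_one (by positivity)]
      have := Finset.card_le_univ s
      rw [Fintype.card_fun, ZMod.card, Fintype.card_fin] at this
      exact_mod_cast this
    nlinarith
  rw [div_le_iff₀ (by positivity), ← sum_iidLaw_rpow_rpow hp hρ]
  have hS : ∑ x : Word m, iidLaw p x ^ (1 / (1 + ρ)) = ∑ x ∈ s, iidLaw p x ^ (1 / (1 + ρ)) := by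
    refine (Finset.sum_subset (Finset.subset_univ s) fun x _ hx => ?_).symm
    have h0 : iidLaw p x = 0 :=
      le_antisymm (by simpa [hs] using hx) (iidLaw_nonneg hp x)
    rw [h0, Real.zero_rpow (by positivity)]
  rw [hS]
  refine (sum_rpow_rpow_le s hρ (fun x _ => iidLaw_nonneg hp x)
    (G := fun x => (κ x : ℝ) + 1) fun x _ => by positivity).trans ?_
  gcongr
  exact Finset.sum_nonneg fun x _ => mul_nonneg (iidLaw_nonneg hp x) (by positivity)

/-! ### Moments of the sizes of weight classes. -/

/-- Type-class form of the upper bound: the `ρ`-th moment of the size of the class of words of the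
same weight. -/
theorem sum_iidLaw_mul_card_rpow_le {m : ℕ} {ρ p : ℝ} (hp : 0 ≤ p ∧ p ≤ 1) (hρ : 0 < ρ) :
    ∑ x : Word m, iidLaw p x * (({z : Word m | hammingNorm z = hammingNorm x}.ncard : ℝ)) ^ ρ
      ≤ 2 ^ (m * (ρ * renyiEntropy (1 / (1 + ρ)) p)) := by
  classical
  rw [← sum_iidLaw_rpow_rpow hp hρ]
  set α := 1 / (1 + ρ) with hα
  have hα' : α + α * ρ = 1 := by rw [hα]; field_simp
  set S := ∑ x : Word m, iidLaw p x ^ α with hS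
  have hS0 : 0 < S := by
    rw [hS, sum_iidLaw_rpow hp]; exact pow_pos (rpow_add_one_sub_rpow_pos hp α) m
  calc _ ≤ ∑ x : Word m, iidLaw p x ^ α * S ^ ρ := by
        refine Finset.sum_le_sum fun x _ => ?_
        have hP := iidLaw_nonneg hp x
        have h1 : iidLaw p x = iidLaw p x ^ α * (iidLaw p x ^ α) ^ ρ := by
          rw [← Real.rpow_mul hP, ← Real.rpow_add' hP (by rw [hα']; exact one_ne_zero), hα',
            Real.rpow_one]
        -- P is constant on the weight class of x, so the left side is the part of the sum S over
        -- that class.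
        have h2 : iidLaw p x ^ α * ({z : Word m | hammingNorm z = hammingNorm x}.ncard : ℝ)
            ≤ S := by
          rw [Set.ncard_eq_toFinset_card', mul_comm, ← nsmul_eq_mul, ← Finset.sum_const]
          calc _ = ∑ z ∈ {z : Word m | hammingNorm z = hammingNorm x}.toFinset,
                iidLaw p z ^ α := by
                refine Finset.sum_congr rfl fun z hz => ?_
                rw [iidLaw_congr p (by simpa using hz : hammingNorm z = hammingNorm x)]
            _ ≤ S := Finset.sum_le_sum_of_subset_of_nonneg (Finset.subset_univ _)
                fun z _ _ => Real.rpow_nonneg (iidLaw_nonneg hp z) _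
        rw [h1, mul_assoc, ← h1, ← Real.mul_rpow (Real.rpow_nonneg hP _) (Nat.cast_nonneg _)]
        gcongr
    _ = S ^ (1 + ρ) := by
        rw [← Finset.sum_mul, ← hS, Real.rpow_add hS0, Real.rpow_one]

/-- 1 + a is at most twice the larger of 1 and a; this treats ρ < 1 and ρ ≥ 1 alike. -/
theorem one_add_rpow_le {a ρ : ℝ} (ha : 0 ≤ a) (hρ : 0 < ρ) :
    (1 + a) ^ ρ ≤ 2 ^ ρ * (1 + a ^ ρ) := by
  rcases le_total a 1 with h | h
  · calc (1 + a) ^ ρ ≤ 2 ^ ρ := Real.rpow_le_rpow (by positivity) (by linarith) hρ.le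
      _ ≤ _ := le_mul_of_one_le_right (by positivity) (by linarith [Real.rpow_nonneg ha ρ])
  · calc (1 + a) ^ ρ ≤ (2 * a) ^ ρ := Real.rpow_le_rpow (by positivity) (by linarith) hρ.le
      _ = 2 ^ ρ * a ^ ρ := Real.mul_rpow (by norm_num) ha
      _ ≤ _ := by gcongr; linarith

/-- Guessing a word within its weight class, thinned out by a factor `2 ^ s`. -/
theorem sum_iidLaw_mul_one_add_rpow_le {m : ℕ} {ρ p : ℝ} (hp : 0 ≤ p ∧ p ≤ 1) (hρ : 0 < ρ)
    (s : ℝ) :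
    ∑ x : Word m, iidLaw p x *
        (1 + ({z : Word m | hammingNorm z = hammingNorm x}.ncard : ℝ) * 2 ^ (-s)) ^ ρ
      ≤ 2 ^ ρ * 2 * 2 ^ max (m * (ρ * renyiEntropy (1 / (1 + ρ)) p) - ρ * s) 0 := by
  calc _ ≤ ∑ x : Word m, 2 ^ ρ * (iidLaw p x + 2 ^ (-(ρ * s)) * (iidLaw p x *
        ({z : Word m | hammingNorm z = hammingNorm x}.ncard : ℝ) ^ ρ)) := by
        refine Finset.sum_le_sum fun x _ => ?_
        have hP := iidLaw_nonneg hp x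
        refine (mul_le_mul_of_nonneg_left
          (one_add_rpow_le (by positivity) hρ) hP).trans_eq ?_
        rw [Real.mul_rpow (Nat.cast_nonneg _) (by positivity), ← Real.rpow_mul (by norm_num)]
        have : -s * ρ = -(ρ * s) := by ring
        rw [this]
        ring
    _ ≤ 2 ^ ρ * (1 + 2 ^ (-(ρ * s)) * 2 ^ (m * (ρ * renyiEntropy (1 / (1 + ρ)) p))) := by
        rw [← Finset.mul_sum, Finset.sum_add_distrib, ← Finset.mul_sum, sum_iidLaw]
        gcongr
        exact sum_iidLaw_mul_card_rpow_le hp hρ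
    _ ≤ 2 ^ ρ * (2 ^ max (m * (ρ * renyiEntropy (1 / (1 + ρ)) p) - ρ * s) 0
          + 2 ^ max (m * (ρ * renyiEntropy (1 / (1 + ρ)) p) - ρ * s) 0) := by
        gcongr
        · exact Real.one_le_rpow (by norm_num) (le_max_right _ _)
        · rw [← Real.rpow_add (by norm_num)]
          refine Real.rpow_le_rpow_of_exponent_le (by norm_num) (le_max_of_le_left ?_)
          linarith
    _ = _ := by ring

/-! ### Entropy estimates: ball volumes, binomial coefficients, tails of the noise. -/

theorem entropy_eq_binEntropy (D : ℝ) : entropy D = Real.binEntropy D / Real.log 2 := by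
  simp only [entropy, Real.binEntropy, Real.logb, Real.log_inv]
  ring

theorem continuous_entropy : Continuous entropy := by
  have : entropy = fun D => Real.binEntropy D / Real.log 2 := funext entropy_eq_binEntropy
  rw [this]
  fun_prop

theorem entropy_zero : entropy 0 = 0 := by simp [entropy]

theorem entropy_nonneg {D : ℝ} (hD : 0 ≤ D ∧ D ≤ 1 / 2) : 0 ≤ entropy D := by
  rw [entropy_eq_binEntropy]
  have := Real.binEntropy_nonneg hD.1 (by linarith [hD.2])
  positivity

theorem entropy_le_one (D : ℝ) : entropy D ≤ 1 := by
  rw [entropy_eq_binEntropy, div_le_one (Real.log_pos (by norm_num))]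
  exact Real.binEntropy_le_log_two

/-- Measures Bernoulli(D) probabilities against 2^(-m H(D)). For D ≤ 1/2 the base (1-D)/D is at
least 1, so words of weight at most m D have probability at least 2^(-m H(D)); this bounds the
volume of the ball. -/
theorem pow_mul_pow_eq {D : ℝ} (h0 : 0 < D) (h1 : D < 1) {m w : ℕ} (hw : w ≤ m) :
    D ^ w * (1 - D) ^ (m - w) = 2 ^ (-(m * entropy D)) * ((1 - D) / D) ^ (m * D - w) := by
  have h2 : 0 < 1 - D := by linarith
  have hl : Real.log 2 ≠ 0 := (Real.log_pos (by norm_num)).ne'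
  refine Real.log_injOn_pos (Set.mem_Ioi.2 (by positivity)) (Set.mem_Ioi.2 (by positivity)) ?_
  rw [Real.log_mul (by positivity) (by positivity), Real.log_mul (by positivity) (by positivity),
    Real.log_pow, Real.log_pow, Real.log_rpow (by norm_num), Real.log_rpow (by positivity),
    Real.log_div h2.ne' h0.ne', entropy, Nat.cast_sub hw, Real.logb, Real.logb]
  field_simp
  ring

/-- The volume of a Hamming ball is at most `2 ^ (m H(D))`. -/
theorem ncard_ball_le {m : ℕ} {D : ℝ} (hD : 0 ≤ D ∧ D ≤ 1 / 2) :
    ({e : Word m | (hammingNorm e : ℝ) ≤ m * D}.ncard : ℝ) ≤ 2 ^ (m * entropy D) := by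
  classical
  rcases hD.1.eq_or_lt with rfl | h0
  · have : {e : Word m | (hammingNorm e : ℝ) ≤ m * 0} ⊆ {0} := by
      intro e he
      have : (hammingNorm e : ℝ) ≤ 0 := by simpa using he
      have : hammingNorm e = 0 := by exact_mod_cast this.antisymm (Nat.cast_nonneg _)
      simpa using this
    have := Set.ncard_le_ncard this
    rw [Set.ncard_singleton] at this
    rw [entropy_zero, mul_zero, Real.rpow_zero]
    exact_mod_cast this
  · have hq : 1 ≤ (1 - D) / D := by rw [le_div_iff₀ h0]; linarith [hD.2]
    rw [← div_le_one (by positivity), div_eq_mul_inv, ← Real.rpow_neg (by norm_num),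
      Set.ncard_eq_toFinset_card', ← nsmul_eq_mul, ← Finset.sum_const, ← sum_iidLaw (m := m) D]
    refine (Finset.sum_le_sum fun e he => ?_).trans
      (Finset.sum_le_sum_of_subset_of_nonneg (Finset.subset_univ _) fun e _ _ =>
        iidLaw_nonneg ⟨h0.le, by linarith [hD.2]⟩ e)
    rw [iidLaw_eq_pow, pow_mul_pow_eq h0 (by linarith [hD.2]) (hammingNorm_le e)]
    refine le_mul_of_one_le_right (by positivity) (Real.one_le_rpow hq ?_)
    have : (hammingNorm e : ℝ) ≤ m * D := by simpa using he
    linarith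

/-- The binomial distribution is at most twice as large anywhere as at the floor of its mean. -/
theorem binomial_le_two_mul {D : ℝ} (h0 : 0 < D) (h1 : D ≤ 1 / 2) (n i : ℕ) :
    (n.choose i : ℝ) * (D ^ i * (1 - D) ^ (n - i))
      ≤ 2 * ((n.choose ⌊n * D⌋₊ : ℝ) * (D ^ ⌊n * D⌋₊ * (1 - D) ^ (n - ⌊n * D⌋₊))) := by
  set a : ℕ → ℝ := fun i => (n.choose i : ℝ) * (D ^ i * (1 - D) ^ (n - i)) with ha
  set k := ⌊n * D⌋₊ with hk
  have hq : 0 < 1 - D := by linarith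
  have hkle : (k : ℝ) ≤ n * D := Nat.floor_le (by positivity)
  have hklt : n * D < k + 1 := Nat.lt_floor_add_one _
  have hnonneg : ∀ i, 0 ≤ a i := fun i => by simp only [ha]; positivity
  -- Ratio of consecutive terms, cleared of denominators. It shows that the terms rise up to k and
  -- fall from k + 1 on.
  have hrec : ∀ i, a (i + 1) * ((i + 1) * (1 - D)) = a i * ((n - i) * D) := by
    intro i
    rcases lt_or_ge i n with hi | hi
    · have hc : (n.choose (i + 1) : ℝ) * (i + 1) = n.choose i * (n - i) := by
        rw [← Nat.cast_sub hi.le]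
        exact_mod_cast Nat.choose_succ_right_eq n i
      have hs : n - i = (n - (i + 1)) + 1 := by omega
      simp only [ha]
      rw [hs, pow_succ, pow_succ]
      linear_combination (D ^ i * D * (1 - D) ^ (n - (i + 1)) * (1 - D)) * hc
    · have h2 : n.choose (i + 1) = 0 := Nat.choose_eq_zero_of_lt (by omega)
      rcases hi.eq_or_lt with rfl | hi
      · simp [ha]
      · have h3 : n.choose i = 0 := Nat.choose_eq_zero_of_lt hi
        simp [ha, h2, h3]
  have hup : ∀ i, i < k → a i ≤ a (i + 1) := by
    intro i hi
    have hi' : (i : ℝ) + 1 ≤ k := by exact_mod_cast hi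
    have hpos : 0 < ((i : ℝ) + 1) * (1 - D) := by positivity
    refine le_of_mul_le_mul_right ?_ hpos
    rw [hrec]
    refine mul_le_mul_of_nonneg_left ?_ (hnonneg i)
    nlinarith
  have hdown : ∀ i, k + 1 ≤ i → a (i + 1) ≤ a i := by
    intro i hi
    have hi' : (k : ℝ) + 1 ≤ i := by exact_mod_cast hi
    have hpos : 0 < ((i : ℝ) + 1) * (1 - D) := by positivity
    refine le_of_mul_le_mul_right ?_ hpos
    rw [hrec]
    refine mul_le_mul_of_nonneg_left ?_ (hnonneg i)
    nlinarith
  -- The mode may be k + 1 instead of k, which is where the factor 2 comes from; D ≤ 1/2 limits the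
  -- last increase.
  have hmid : a (k + 1) ≤ 2 * a k := by
    have hpos : 0 < ((k : ℝ) + 1) * (1 - D) := by positivity
    refine le_of_mul_le_mul_right ?_ hpos
    rw [hrec]
    have : ((n : ℝ) - k) * D ≤ 2 * ((k + 1) * (1 - D)) := by
      have hk0 : (0 : ℝ) ≤ k := Nat.cast_nonneg k
      nlinarith
    calc a k * ((n - k) * D) ≤ a k * (2 * ((k + 1) * (1 - D))) :=
          mul_le_mul_of_nonneg_left this (hnonneg k)
      _ = _ := by ring
  change a i ≤ 2 * a k
  rcases le_or_gt i k with hi | hi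
  · have hmono : ∀ j, i ≤ j → j ≤ k → a i ≤ a j := by
      intro j hj
      induction j, hj using Nat.le_induction with
      | base => exact fun _ => le_rfl
      | succ j _ ih => exact fun h => (ih (by omega)).trans (hup j (by omega))
    linarith [hmono k hi le_rfl, hnonneg k]
  · have hanti : ∀ j, k + 1 ≤ j → a j ≤ a (k + 1) := by
      intro j hj
      induction j, hj using Nat.le_induction with
      | base => exact le_rfl
      | succ j hj ih => exact (hdown j hj).trans ih
    exact (hanti i hi).trans hmid

/-- The n + 1 binomial probabilities sum to 1 and each is at most twice the one at k = ⌊n D⌋. That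
one is at most C(n,k) 2^(-n H(D)) (1-D)/D because n D - k ≤ 1. Hence c = D / (2 (1-D)) for D > 0. -/
theorem exists_le_choose_floor {D : ℝ} (hD : 0 ≤ D ∧ D ≤ 1 / 2) :
    ∃ c : ℝ, 0 < c ∧ ∀ n : ℕ, c * 2 ^ (n * entropy D) / (n + 1) ≤ n.choose ⌊n * D⌋₊ := by
  rcases hD.1.eq_or_lt with rfl | h0
  · refine ⟨1, one_pos, fun n => ?_⟩
    simp only [entropy_zero, mul_zero, Real.rpow_zero, Nat.floor_zero, Nat.choose_zero_right,
      Nat.cast_one]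
    rw [div_le_one (by positivity)]
    linarith [(Nat.cast_nonneg n : (0 : ℝ) ≤ n)]
  have hq : 0 < 1 - D := by linarith [hD.2]
  refine ⟨D / (2 * (1 - D)), by positivity, fun n => ?_⟩
  set k := ⌊n * D⌋₊ with hk
  have hkle : (k : ℝ) ≤ n * D := Nat.floor_le (by positivity)
  have hklt : n * D < k + 1 := Nat.lt_floor_add_one _
  have hkn : k ≤ n := by
    have : (k : ℝ) ≤ n := by nlinarith [hD.2, (Nat.cast_nonneg n : (0 : ℝ) ≤ n)]
    exact_mod_cast this
  have hsum : (1 : ℝ) ≤ (n + 1) * (2 * ((n.choose k : ℝ) * (D ^ k * (1 - D) ^ (n - k)))) := by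
    have h := add_pow D (1 - D) n
    rw [add_sub_cancel, one_pow] at h
    refine h.le.trans ?_
    refine (Finset.sum_le_sum fun i _ => ?_).trans_eq
      (b := ∑ i ∈ Finset.range (n + 1), 2 * ((n.choose k : ℝ) * (D ^ k * (1 - D) ^ (n - k)))) ?_
    · rw [mul_comm]
      exact binomial_le_two_mul h0 hD.2 n i
    · rw [Finset.sum_const, Finset.card_range, nsmul_eq_mul]
      push_cast
      rfl
  rw [pow_mul_pow_eq h0 (by linarith) hkn] at hsum
  have hpow : ((1 - D) / D) ^ (n * D - k) ≤ (1 - D) / D := by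
    calc _ ≤ ((1 - D) / D) ^ (1 : ℝ) := Real.rpow_le_rpow_of_exponent_le
          (by rw [le_div_iff₀ h0]; linarith [hD.2]) (by linarith)
      _ = _ := Real.rpow_one _
  have h2 : (1 : ℝ) ≤ (n + 1) * (2 * ((n.choose k : ℝ) *
      (2 ^ (-(n * entropy D)) * ((1 - D) / D)))) := by
    refine hsum.trans ?_
    gcongr
  rw [div_le_iff₀ (by positivity)]
  have h3 : D / (2 * (1 - D)) * 2 ^ (n * entropy D) * 1 ≤ D / (2 * (1 - D)) * 2 ^ (n * entropy D) *
      ((n + 1) * (2 * ((n.choose k : ℝ) * (2 ^ (-(n * entropy D)) * ((1 - D) / D))))) := by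
    gcongr
  rw [mul_one] at h3
  refine h3.trans_eq ?_
  rw [Real.rpow_neg (by norm_num)]
  field_simp

/-- Chernoff bound for the weight of the noise. -/
theorem sum_iidLaw_tail_le {m : ℕ} {D δ : ℝ} (hD : 0 ≤ D ∧ D ≤ 1 / 2) (hδ : 0 ≤ δ ∧ δ ≤ 1) :
    ∑ e : Word m with (m * (D + δ) < hammingNorm e), iidLaw D e
      ≤ Real.exp (-(m * δ ^ 2 / 2)) := by
  have hD1 : 0 ≤ D ∧ D ≤ 1 := ⟨hD.1, by linarith [hD.2]⟩
  have hgen : ∑ e : Word m, iidLaw D e * Real.exp (δ * hammingNorm e)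
      = (1 - D + D * Real.exp δ) ^ m := by
    have h := sum_prod_bits (m := m) fun a => if a = 1 then D * Real.exp δ else 1 - D
    simp only [zero_ne_one, if_false, if_true] at h
    rw [← h]
    refine Finset.sum_congr rfl fun e _ => ?_
    have he : Real.exp (δ * hammingNorm e) = ∏ i, if e i = 1 then Real.exp δ else 1 := by
      simp_rw [bit_eq_one_iff]
      rw [Finset.prod_ite, Finset.prod_const, Finset.prod_const_one, mul_one, mul_comm,
        Real.exp_nat_mul]
      rfl
    rw [he, iidLaw, ← Finset.prod_mul_distrib]
    refine Finset.prod_congr rfl fun i _ => ?_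
    split_ifs <;> ring
  -- The Chernoff parameter is δ itself; e^δ ≤ 1 + δ + δ² on [0, 1].
  have hexp : 1 - D + D * Real.exp δ ≤ Real.exp (D * (δ + δ ^ 2)) := by
    have h1 := Real.abs_exp_sub_one_sub_id_le (x := δ) (by rw [abs_of_nonneg hδ.1]; exact hδ.2)
    have h2 := (abs_le.1 h1).2
    have h3 := Real.add_one_le_exp (D * (δ + δ ^ 2))
    nlinarith [hD.1]
  calc _ ≤ ∑ e : Word m with (m * (D + δ) < hammingNorm e),
        iidLaw D e * Real.exp (δ * hammingNorm e) * Real.exp (-(δ * (m * (D + δ)))) := by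
        refine Finset.sum_le_sum fun e he => ?_
        rw [mul_assoc, ← Real.exp_add]
        refine le_mul_of_one_le_right (iidLaw_nonneg hD1 e) (Real.one_le_exp ?_)
        have := (Finset.mem_filter.1 he).2
        nlinarith [hδ.1]
    _ ≤ ∑ e : Word m,
        iidLaw D e * Real.exp (δ * hammingNorm e) * Real.exp (-(δ * (m * (D + δ)))) :=
        Finset.sum_le_sum_of_subset_of_nonneg (Finset.subset_univ _) fun e _ _ =>
          mul_nonneg (mul_nonneg (iidLaw_nonneg hD1 e) (Real.exp_nonneg _)) (Real.exp_nonneg _)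
    _ = (1 - D + D * Real.exp δ) ^ m * Real.exp (-(δ * (m * (D + δ)))) := by
        rw [← Finset.sum_mul, hgen]
    _ ≤ Real.exp (D * (δ + δ ^ 2)) ^ m * Real.exp (-(δ * (m * (D + δ)))) := by
        gcongr
        have := Real.exp_nonneg δ
        nlinarith [hD.1, hD.2]
    _ ≤ _ := by
        rw [← Real.exp_nat_mul, ← Real.exp_add]
        refine Real.exp_le_exp.2 ?_
        -- The exponents add up to -(1 - D) m δ², and D ≤ 1/2.
        have : 0 ≤ (m : ℝ) * δ ^ 2 := by positivity
        nlinarith [hD.2]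

/-! ### Covering a weight class by permuted copies of a ball. -/

/-- Greedy covering: if every point lies in a fraction `s` of the sets, then `N` suitably chosen
sets miss at most a fraction `(1 - s) ^ N` of the points. -/
theorem exists_greedy_cover {ι α : Type*} [Fintype ι] [Nonempty ι] [DecidableEq α]
    (T : Finset α) (A : ι → Finset α) {s : ℝ} (hs : s ≤ 1)
    (h : ∀ x ∈ T, s * Fintype.card ι ≤ ((Finset.univ.filter fun i => x ∈ A i).card : ℝ)) (N : ℕ) :
    ∃ l : ℕ → ι, ((T.filter fun x => ∀ i < N, x ∉ A (l i)).card : ℝ) ≤ (1 - s) ^ N * T.card := by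
  induction N with
  | zero => exact ⟨fun _ => Classical.arbitrary ι, by simp⟩
  | succ N ih =>
    obtain ⟨l, hl⟩ := ih
    set U := T.filter fun x => ∀ i < N, x ∉ A (l i) with hU
    -- Averaged over all sets, a fraction s of the uncovered points U is hit, so one set does at
    -- least as well.
    obtain ⟨i, hi⟩ : ∃ i, s * U.card ≤ ((U.filter fun x => x ∈ A i).card : ℝ) := by
      obtain ⟨i, -, hi⟩ := Finset.exists_le_of_sum_le (s := (Finset.univ : Finset ι))
        (f := fun _ => s * U.card) (g := fun i => ((U.filter fun x => x ∈ A i).card : ℝ))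
        Finset.univ_nonempty (by
          have hcomm : ∑ i, ((U.filter fun x => x ∈ A i).card : ℝ)
              = ∑ x ∈ U, ((Finset.univ.filter fun i => x ∈ A i).card : ℝ) := by
            simp_rw [Finset.card_filter, Nat.cast_sum]
            exact Finset.sum_comm
          rw [hcomm, Finset.sum_const, Finset.card_univ, nsmul_eq_mul]
          refine le_trans (le_of_eq ?_) (Finset.sum_le_sum fun x hx =>
            h x (Finset.mem_filter.1 hx).1)
          rw [Finset.sum_const, nsmul_eq_mul]
          ring)
      exact ⟨i, hi⟩
    refine ⟨fun k => if k < N then l k else i, ?_⟩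
    have hsub : (T.filter fun x => ∀ k < N + 1, x ∉ A (if k < N then l k else i))
        = U.filter fun x => x ∉ A i := by
      ext x
      simp only [hU, Finset.mem_filter, and_assoc]
      refine and_congr_right fun _ => ⟨fun hx => ⟨fun k hk => ?_, ?_⟩, fun hx k hk => ?_⟩
      · simpa [hk] using hx k (by omega)
      · simpa using hx N (by omega)
      · split_ifs with hkN
        · exact hx.1 k hkN
        · exact hx.2
    have hsplit : ((U.filter fun x => x ∈ A i).card : ℝ) + (U.filter fun x => x ∉ A i).card
        = U.card := by
      exact_mod_cast Finset.card_filter_add_card_filter_not (s := U) (fun x => x ∈ A i)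
    rw [hsub, pow_succ]
    have := mul_le_mul_of_nonneg_left hl (sub_nonneg.2 hs)
    linarith

section Permutation

variable {m : ℕ}

theorem hammingDist_comp_perm (x y : Word m) (σ : Equiv.Perm (Fin m)) :
    hammingDist (x ∘ σ) (y ∘ σ) = hammingDist x y := by
  unfold hammingDist
  refine Finset.card_bij (fun i _ => σ i) ?_ (fun _ _ _ _ h => σ.injective h) fun i hi => ?_
  · intro i hi
    simpa using hi
  · exact ⟨σ.symm i, by simpa using hi, by simp⟩

theorem hammingNorm_comp_perm (x : Word m) (σ : Equiv.Perm (Fin m)) :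
    hammingNorm (x ∘ σ) = hammingNorm x := by
  have h := hammingDist_comp_perm x 0 σ
  rw [hammingDist_zero_right] at h
  rw [← h, ← hammingDist_zero_right]
  rfl

theorem exists_perm_of_hammingNorm_eq {x y : Word m} (h : hammingNorm x = hammingNorm y) :
    ∃ σ : Equiv.Perm (Fin m), y ∘ σ = x := by
  obtain ⟨σ, hσ⟩ := Equiv.Perm.exists_map_finset_eq (Finset.univ.filter fun i => x i ≠ 0)
    (Finset.univ.filter fun i => y i ≠ 0) h
  refine ⟨σ, funext fun i => ?_⟩
  have hi : y (σ i) ≠ 0 ↔ x i ≠ 0 := by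
    have : σ i ∈ (Finset.univ.filter fun i => y i ≠ 0) ↔ x i ≠ 0 := by
      rw [← hσ]
      simp
    simpa using this
  have hbit : ∀ a b : ZMod 2, (a ≠ 0 ↔ b ≠ 0) → a = b := by decide
  exact hbit _ _ hi

/-- Double counting of pairs (σ, z) with z ∘ σ ∈ A: permutations act transitively on the weight
class, so the count for fixed z does not depend on z, while each σ contributes |A|. Thus every word
lies in the same fraction of the permuted copies of A, as greedy covering requires. -/
theorem card_perm_mul_card {t : ℕ} (A : Finset (Word m)) (hA : ∀ x ∈ A, hammingNorm x = t)
    {x : Word m} (hx : hammingNorm x = t) :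
    (Finset.univ.filter fun σ : Equiv.Perm (Fin m) => x ∘ σ ∈ A).card
        * (Finset.univ.filter fun z : Word m => hammingNorm z = t).card
      = Fintype.card (Equiv.Perm (Fin m)) * A.card := by
  have hconst : ∀ z ∈ Finset.univ.filter fun z : Word m => hammingNorm z = t,
      (Finset.univ.filter fun σ : Equiv.Perm (Fin m) => z ∘ σ ∈ A).card
        = (Finset.univ.filter fun σ : Equiv.Perm (Fin m) => x ∘ σ ∈ A).card := by
    intro z hz
    obtain ⟨τ, hτ⟩ := exists_perm_of_hammingNorm_eq (((Finset.mem_filter.1 hz).2).trans hx.symm)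
    refine Finset.card_bij (fun σ _ => τ * σ) ?_ (fun _ _ _ _ h => mul_left_cancel h) ?_
    · intro σ hσ
      simp only [Finset.mem_filter, Finset.mem_univ, true_and] at hσ ⊢
      rw [← hτ] at hσ
      exact hσ
    · intro σ hσ
      refine ⟨τ⁻¹ * σ, ?_, by simp⟩
      simp only [Finset.mem_filter, Finset.mem_univ, true_and] at hσ ⊢
      rw [← hτ]
      convert hσ using 1
      ext i
      simp
  have hfix : ∀ σ : Equiv.Perm (Fin m),
      ((Finset.univ.filter fun z : Word m => hammingNorm z = t).filter fun z => z ∘ σ ∈ A).card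
        = A.card := by
    intro σ
    refine Finset.card_bij (fun z _ => z ∘ σ) ?_ ?_ ?_
    · intro z hz
      exact (Finset.mem_filter.1 hz).2
    · intro z _ z' _ h
      exact σ.surjective.injective_comp_right h
    · intro z hz
      refine ⟨z ∘ σ.symm, ?_, ?_⟩
      · simp only [Finset.mem_filter, Finset.mem_univ, true_and]
        refine ⟨(hammingNorm_comp_perm z σ.symm).trans (hA z hz), ?_⟩
        convert hz using 1
        ext i
        simp
      · ext i
        simp
  rw [mul_comm, ← smul_eq_mul, ← Finset.sum_const, ← Finset.sum_congr rfl hconst]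
  simp_rw [Finset.card_filter]
  rw [Finset.sum_comm]
  simp_rw [← Finset.card_filter, hfix]
  rw [Finset.sum_const, Finset.card_univ, smul_eq_mul]

/-- A weight class is covered by few balls if one ball covers a substantial part of it. -/
theorem exists_guesses_of_ball {t : ℕ} {R : ℝ} (y₀ : Word m) {A : Finset (Word m)}
    (hA : ∀ x ∈ A, hammingNorm x = t ∧ (hammingDist x y₀ : ℝ) ≤ R) (hne : A.Nonempty) :
    ∃ (g : ℕ → Word m), ∀ x, hammingNorm x = t →
      guessCount g {y | (hammingDist x y : ℝ) ≤ R} ≤ ENNReal.ofReal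
        (1 + m * ({z : Word m | hammingNorm z = t}.ncard / A.card)) := by
  classical
  set T := Finset.univ.filter fun z : Word m => hammingNorm z = t with hT
  have hTc : {z : Word m | hammingNorm z = t}.ncard = T.card := by
    rw [Set.ncard_eq_toFinset_card']; simp [hT]
  rw [hTc]
  have hAT : A ⊆ T := fun x hx => by simp [hT, (hA x hx).1]
  have hA0 : (0 : ℝ) < A.card := by exact_mod_cast hne.card_pos
  have hT0 : (0 : ℝ) < T.card := by exact_mod_cast (hne.mono hAT).card_pos
  set s : ℝ := A.card / T.card with hs
  have hs0 : 0 < s := by positivity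
  have hs1 : s ≤ 1 := by
    rw [hs, div_le_one hT0]; exact_mod_cast Finset.card_le_card hAT
  -- With s N > m, fewer than e^(-m) |T| ≤ e^(-m) 2^m ≤ 1 words stay uncovered, hence none.
  set N : ℕ := ⌊(m : ℝ) * (T.card / A.card)⌋₊ + 1 with hN
  obtain ⟨l, hl⟩ := exists_greedy_cover T
    (fun σ : Equiv.Perm (Fin m) => Finset.univ.filter fun x : Word m => x ∘ σ ∈ A) hs1 (by
      intro x hx
      have h := card_perm_mul_card A (fun x hx => (hA x hx).1) (Finset.mem_filter.1 hx).2
      have h' : ((Finset.univ.filter fun σ : Equiv.Perm (Fin m) => x ∘ σ ∈ A).card : ℝ) * T.card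
        = Fintype.card (Equiv.Perm (Fin m)) * A.card := by exact_mod_cast h
      simp only [Finset.mem_filter, Finset.mem_univ, true_and]
      refine le_of_eq ?_
      rw [hs, div_mul_eq_mul_div, div_eq_iff hT0.ne', h']
      ring) N
  have hsN : (m : ℝ) < s * N := by
    have h1 : (m : ℝ) * (T.card / A.card) < N := by
      rw [hN]; push_cast; exact Nat.lt_floor_add_one _
    calc (m : ℝ) = s * (m * (T.card / A.card)) := by rw [hs]; field_simp
      _ < _ := by gcongr
  have hlt : (1 - s) ^ N * (T.card : ℝ) < 1 := by
    have h1 : (1 - s) ^ N ≤ Real.exp (-(s * N)) := by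
      calc (1 - s) ^ N ≤ Real.exp (-s) ^ N := by
            gcongr
            linarith [Real.add_one_le_exp (-s)]
        _ = _ := by rw [← Real.exp_nat_mul]; congr 1; ring
    have h2 : Real.exp (-(s * N)) < Real.exp (-m) := Real.exp_lt_exp.2 (by linarith)
    have h3 : (T.card : ℝ) ≤ Real.exp m := by
      have h4 : T.card ≤ 2 ^ m := by
        have := Finset.card_le_univ T
        rwa [Fintype.card_fun, ZMod.card, Fintype.card_fin] at this
      calc (T.card : ℝ) ≤ 2 ^ m := by exact_mod_cast h4
        _ ≤ Real.exp 1 ^ m := by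
          gcongr
          linarith [Real.add_one_le_exp 1]
        _ = _ := by rw [← Real.exp_nat_mul, mul_one]
    calc (1 - s) ^ N * (T.card : ℝ) ≤ Real.exp (-(s * N)) * T.card := by gcongr
      _ < Real.exp (-m) * T.card := by gcongr
      _ ≤ Real.exp (-m) * Real.exp m := by gcongr
      _ = 1 := by rw [← Real.exp_add]; simp
  refine ⟨fun i => y₀ ∘ (l i).symm, fun x hx => ?_⟩
  obtain ⟨i, hi, hxi⟩ : ∃ i < N, x ∘ l i ∈ A := by
    by_contra hcon
    push Not at hcon
    have hmem : x ∈ T.filter fun x => ∀ i < N,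
        x ∉ Finset.univ.filter fun x : Word m => x ∘ l i ∈ A := by
      simp only [Finset.mem_filter, Finset.mem_univ, true_and, hT]
      exact ⟨hx, hcon⟩
    have hpos : (1 : ℝ) ≤ (T.filter fun x => ∀ i < N,
        x ∉ Finset.univ.filter fun x : Word m => x ∘ l i ∈ A).card := by
      exact_mod_cast Finset.card_pos.2 ⟨x, hmem⟩
    linarith
  refine (guessCount_le (k := i) ?_).trans ?_
  · have h := (hA _ hxi).2
    rw [← hammingDist_comp_perm _ _ (l i).symm] at h
    have he : (x ∘ l i) ∘ (l i).symm = x := by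
      ext j
      simp
    rw [he] at h
    exact h
  · rw [← ENNReal.ofReal_natCast]
    refine ENNReal.ofReal_le_ofReal ?_
    have h1 : ((i + 1 : ℕ) : ℝ) ≤ N := by exact_mod_cast hi
    refine h1.trans ?_
    rw [hN]
    push_cast
    have := Nat.floor_le (a := (m : ℝ) * (T.card / A.card)) (by positivity)
    linarith

end Permutation

/-! ### Intersections of balls with weight classes. -/

section Indicator

variable {m : ℕ}

/-- The word with support `J`. -/
def indicatorWord (J : Finset (Fin m)) : Word m := fun i => if i ∈ J then 1 else 0

theorem hammingNorm_indicatorWord (J : Finset (Fin m)) :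
    hammingNorm (indicatorWord J) = J.card := by
  unfold hammingNorm indicatorWord
  congr 1
  ext i
  simp

theorem hammingDist_indicatorWord (J K : Finset (Fin m)) :
    hammingDist (indicatorWord J) (indicatorWord K) = (symmDiff J K).card := by
  unfold hammingDist indicatorWord
  congr 1
  ext i
  by_cases h1 : i ∈ J <;> by_cases h2 : i ∈ K <;> simp [h1, h2, Finset.mem_symmDiff]

theorem indicatorWord_injective : Function.Injective (indicatorWord (m := m)) := by
  intro J K h
  rw [← Finset.symmDiff_eq_empty, ← Finset.card_eq_zero, ← hammingDist_indicatorWord, h,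
    hammingDist_self]

/-- Words of weight `j - a + b` at distance `a + b` from a word of weight `j`. -/
theorem exists_ball_choose {j a b t : ℕ} {R : ℝ} (hj : j ≤ m) (ht : j - a + b = t)
    (hR : ((a + b : ℕ) : ℝ) ≤ R) :
    ∃ (y : Word m) (A : Finset (Word m)),
      (∀ x ∈ A, hammingNorm x = t ∧ (hammingDist x y : ℝ) ≤ R) ∧
      A.card = j.choose a * (m - j).choose b := by
  classical
  obtain ⟨J, -, hJ⟩ := Finset.exists_subset_card_eq (s := (Finset.univ : Finset (Fin m)))
    (n := j) (by simpa using hj)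
  have hJc : Jᶜ.card = m - j := by rw [Finset.card_compl, hJ, Fintype.card_fin]
  -- The words of A delete a of the j ones of the centre and add b ones outside its support.
  refine ⟨indicatorWord J, (J.powersetCard a ×ˢ Jᶜ.powersetCard b).image
    fun q => indicatorWord (J \ q.1 ∪ q.2), ?_, ?_⟩
  · intro x hx
    obtain ⟨⟨U, V⟩, hUV, rfl⟩ := Finset.mem_image.1 hx
    obtain ⟨hU, hV⟩ := Finset.mem_product.1 hUV
    obtain ⟨hU1, hU2⟩ := Finset.mem_powersetCard.1 hU
    obtain ⟨hV1, hV2⟩ := Finset.mem_powersetCard.1 hV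
    dsimp only at hU1 hU2 hV1 hV2 ⊢
    have hJV : Disjoint J V :=
      (Finset.disjoint_left.2 fun i hi hi' => (Finset.mem_compl.1 (hV1 hi')) hi)
    constructor
    · rw [hammingNorm_indicatorWord, Finset.card_union_of_disjoint
        (hJV.mono_left Finset.sdiff_subset), Finset.card_sdiff_of_subset hU1, hJ, hU2, hV2, ht]
    · have : symmDiff (J \ U ∪ V) J = U ∪ V := by
        ext i
        have h1 := @hU1 i
        have h2 : i ∈ V → i ∉ J := fun h => Finset.mem_compl.1 (hV1 h)
        simp only [Finset.mem_symmDiff, Finset.mem_union, Finset.mem_sdiff]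
        tauto
      rw [hammingDist_indicatorWord, this, Finset.card_union_of_disjoint (hJV.mono_left hU1),
        hU2, hV2]
      exact hR
  · rw [Finset.card_image_of_injOn, Finset.card_product, Finset.card_powersetCard,
      Finset.card_powersetCard, hJ, hJc]
    rintro ⟨U, V⟩ h ⟨U', V'⟩ h' he
    simp only [Finset.coe_product, Set.mem_prod, Finset.mem_coe, Finset.mem_powersetCard] at h h'
    have he' := indicatorWord_injective he
    have hmem : ∀ i, (i ∈ J \ U ∪ V ↔ i ∈ J \ U' ∪ V') := fun i => by rw [he']
    simp only [Finset.mem_union, Finset.mem_sdiff] at hmem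
    have hV : ∀ i ∈ V, i ∉ J := fun i hi => Finset.mem_compl.1 (h.2.1 hi)
    have hV' : ∀ i ∈ V', i ∉ J := fun i hi => Finset.mem_compl.1 (h'.2.1 hi)
    refine Prod.ext (Finset.ext fun i => ?_) (Finset.ext fun i => ?_)
    · have := hmem i; have := hV i; have := hV' i; have := @h.1.1 i; have := @h'.1.1 i
      dsimp only at *
      tauto
    · have := hmem i; have := hV i; have := hV' i; have := @h.1.1 i; have := @h'.1.1 i
      dsimp only at *
      tauto

end Indicator

/-- Discrete intermediate value property. -/
theorem exists_eq_of_step_le {f : ℕ → ℕ} {m t : ℕ} (hstep : ∀ j < m, f (j + 1) ≤ f j + 1)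
    (h0 : f 0 ≤ t) (hm : t ≤ f m) : ∃ j ≤ m, f j = t := by
  classical
  have hex : ∃ j, t ≤ f j := ⟨m, hm⟩
  have hle : Nat.find hex ≤ m := Nat.find_min' hex hm
  -- Only upward jumps are limited, so the first index at which f reaches t must hit t exactly.
  refine ⟨Nat.find hex, hle, le_antisymm ?_ (Nat.find_spec hex)⟩
  rcases h : Nat.find hex with _ | j
  · exact h0
  · have h1 : ¬ t ≤ f j := Nat.find_min hex (by omega)
    have := hstep j (by omega)
    omega

/-- Some ball of radius `m D` covers a weight class, or at least a part of it of size close to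
`2 ^ (m H(D))`. -/
theorem exists_ball {D : ℝ} (hD : 0 ≤ D ∧ D ≤ 1 / 2) :
    ∃ K : ℝ, 0 < K ∧ ∀ m t : ℕ, t ≤ m → ∃ (y : Word m) (A : Finset (Word m)), A.Nonempty ∧
      (∀ x ∈ A, hammingNorm x = t ∧ (hammingDist x y : ℝ) ≤ m * D) ∧
      ({z : Word m | hammingNorm z = t}.ncard : ℝ) / A.card
        ≤ 1 + K * (m + 1) ^ 2 * ({z : Word m | hammingNorm z = t}.ncard * 2 ^ (-(m * entropy D))) := by
  classical
  obtain ⟨c, hc0, hc⟩ := exists_le_choose_floor hD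
  refine ⟨(c ^ 2)⁻¹, by positivity, fun m t ht => ?_⟩
  set d := ⌊m * D⌋₊ with hd
  have hmD : (0 : ℝ) ≤ m * D := mul_nonneg (Nat.cast_nonneg _) hD.1
  have hdle : (d : ℝ) ≤ m * D := Nat.floor_le hmD
  have hfl : ∀ n : ℕ, ⌊n * D⌋₊ ≤ n := fun n => by
    refine Nat.floor_le_of_le ?_
    nlinarith [(Nat.cast_nonneg n : (0 : ℝ) ≤ n), hD.2]
  have hdm : d ≤ m := hfl m
  have hTne : (Finset.univ.filter fun z : Word m => hammingNorm z = t).Nonempty := by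
    obtain ⟨J, -, hJ⟩ := Finset.exists_subset_card_eq (s := (Finset.univ : Finset (Fin m)))
      (n := t) (by simpa using ht)
    exact ⟨indicatorWord J, by simp [hammingNorm_indicatorWord, hJ]⟩
  have hTc : {z : Word m | hammingNorm z = t}.ncard
      = (Finset.univ.filter fun z : Word m => hammingNorm z = t).card := by
    rw [Set.ncard_eq_toFinset_card']; simp
  have hfull : ((({z : Word m | hammingNorm z = t}.ncard : ℝ)) /
      (Finset.univ.filter fun z : Word m => hammingNorm z = t).card)
        ≤ 1 + (c ^ 2)⁻¹ * (m + 1) ^ 2 *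
          ({z : Word m | hammingNorm z = t}.ncard * 2 ^ (-(m * entropy D))) := by
    rw [hTc, div_self (by exact_mod_cast hTne.card_pos.ne')]
    have : (0 : ℝ) ≤ (c ^ 2)⁻¹ * (m + 1) ^ 2 * ((Finset.univ.filter fun z : Word m =>
      hammingNorm z = t).card * 2 ^ (-(m * entropy D))) := by positivity
    linarith
  -- Very light classes lie in the ball around 0, very heavy ones in the ball around the all-ones
  -- word.
  rcases lt_or_ge t d with h1 | h1
  · refine ⟨0, _, hTne, fun x hx => ?_, hfull⟩
    have hx' := (Finset.mem_filter.1 hx).2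
    refine ⟨hx', ?_⟩
    rw [hammingDist_zero_right, hx']
    exact le_trans (by exact_mod_cast h1.le) hdle
  rcases lt_or_ge (m - d) t with h2 | h2
  · refine ⟨fun _ => 1, _, hTne, fun x hx => ?_, hfull⟩
    have hx' := (Finset.mem_filter.1 hx).2
    refine ⟨hx', ?_⟩
    have hdist : hammingDist x (fun _ => 1) + hammingNorm x = m := by
      have h := Finset.card_filter_add_card_filter_not (s := (Finset.univ : Finset (Fin m)))
        (fun i => x i ≠ 1)
      rw [Finset.card_univ, Fintype.card_fin] at h
      refine Eq.trans ?_ h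
      unfold hammingDist hammingNorm
      simp_rw [← bit_eq_one_iff, not_not]
    refine le_trans ?_ hdle
    exact_mod_cast (by omega : hammingDist x (fun _ => 1) ≤ d)
  -- A centre of weight j is altered in a fraction D of its ones and a fraction D of its zeros. The
  -- resulting weight runs from d at j = 0 to m - d at j = m with upward steps of at most 1, so some
  -- j gives t.
  obtain ⟨j, hj, hjt⟩ := exists_eq_of_step_le
    (f := fun j => j - ⌊j * D⌋₊ + ⌊((m - j : ℕ) : ℝ) * D⌋₊) (m := m) (t := t) (by
      intro j hj
      have e1 : ⌊(j : ℝ) * D⌋₊ ≤ ⌊((j + 1 : ℕ) : ℝ) * D⌋₊ := by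
        gcongr
        · exact hD.1
        · omega
      have e2 : ⌊((m - (j + 1) : ℕ) : ℝ) * D⌋₊ ≤ ⌊((m - j : ℕ) : ℝ) * D⌋₊ := by
        gcongr
        · exact hD.1
        · omega
      omega) (by simpa using h1) (by simpa using h2)
  obtain ⟨y, A, hA, hAc⟩ := exists_ball_choose (R := m * D) hj hjt (by
    have e1 : (⌊(j : ℝ) * D⌋₊ : ℝ) ≤ j * D := Nat.floor_le (mul_nonneg (Nat.cast_nonneg _) hD.1)
    have e2 : (⌊((m - j : ℕ) : ℝ) * D⌋₊ : ℝ) ≤ ((m - j : ℕ) : ℝ) * D :=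
      Nat.floor_le (mul_nonneg (Nat.cast_nonneg _) hD.1)
    have e3 : ((m - j : ℕ) : ℝ) = m - j := Nat.cast_sub hj
    push_cast
    rw [e3] at e2 ⊢
    nlinarith)
  -- Both binomial coefficients are taken at the same fraction D, so their exponents j H(D) and (m -
  -- j) H(D) add up to m H(D).
  have hcard : c ^ 2 * 2 ^ (m * entropy D) / (m + 1) ^ 2 ≤ (A.card : ℝ) := by
    rw [hAc]
    push_cast
    have e1 := hc j
    have e2 := hc (m - j)
    have e3 : ((m - j : ℕ) : ℝ) = m - j := Nat.cast_sub hj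
    have hjm : (j : ℝ) ≤ m := by exact_mod_cast hj
    have hj0 : (0 : ℝ) ≤ j := Nat.cast_nonneg j
    calc c ^ 2 * 2 ^ (m * entropy D) / (m + 1) ^ 2
        = (c * 2 ^ (j * entropy D) / (m + 1)) * (c * 2 ^ (((m - j : ℕ) : ℝ) * entropy D) / (m + 1)) := by
          have : (m : ℝ) * entropy D = j * entropy D + ((m - j : ℕ) : ℝ) * entropy D := by
            rw [e3]; ring
          rw [this, Real.rpow_add (by norm_num)]
          field_simp
      _ ≤ (c * 2 ^ (j * entropy D) / (j + 1)) *
          (c * 2 ^ (((m - j : ℕ) : ℝ) * entropy D) / ((m - j : ℕ) + 1)) := by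
          gcongr
          exact Nat.sub_le m j
      _ ≤ _ := mul_le_mul e1 e2 (by positivity) (by positivity)
  have hApos : (0 : ℝ) < A.card := lt_of_lt_of_le (by positivity) hcard
  refine ⟨y, A, Finset.card_pos.1 (by exact_mod_cast hApos), hA, ?_⟩
  calc ({z : Word m | hammingNorm z = t}.ncard : ℝ) / A.card
      ≤ {z : Word m | hammingNorm z = t}.ncard / (c ^ 2 * 2 ^ (m * entropy D) / (m + 1) ^ 2) := by
        gcongr
    _ = (c ^ 2)⁻¹ * (m + 1) ^ 2 *
          ({z : Word m | hammingNorm z = t}.ncard * 2 ^ (-(m * entropy D))) := by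
        rw [Real.rpow_neg (by norm_num)]
        field_simp
    _ ≤ _ := by linarith

/-! ### Upper bound for the distortion game. -/

/-- Non-asymptotic upper bound on the guesswork up to distortion. -/
theorem exists_distortionMoment_le {p D ρ : ℝ} (hp : 0 ≤ p ∧ p ≤ 1) (hD : 0 ≤ D ∧ D ≤ 1 / 2)
    (hρ : 0 < ρ) :
    ∃ K : ℝ, 0 < K ∧ ∀ m : ℕ, distortionMoment ρ p D m ≤ ENNReal.ofReal (K * (m + 1 : ℝ) ^ (4 * ρ) *
      2 ^ max (m * (ρ * renyiEntropy (1 / (1 + ρ)) p) - ρ * (m * entropy D)) 0) := by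
  obtain ⟨K, hK, hball⟩ := exists_ball hD
  refine ⟨(2 + K) ^ ρ * (2 ^ ρ * 2), by positivity, fun m => ?_⟩
  choose! y A hAne hA hcard using hball m
  choose! g hg using fun t ht => exists_guesses_of_ball (y t) (hA t ht) (hAne t ht)
  obtain ⟨f, hf⟩ := exists_interleave (M := m + 1) g
  set T : Word m → ℝ := fun x => ({z : Word m | hammingNorm z = hammingNorm x}.ncard : ℝ) with hT
  have hbound : ∀ x : Word m, guessCount f {y | (hammingDist x y : ℝ) ≤ m * D}
      ≤ ENNReal.ofReal ((2 + K) * (m + 1) ^ 4 * (1 + T x * 2 ^ (-(m * entropy D)))) := by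
    intro x
    have hx := hammingNorm_le x
    refine (hf _ (Nat.lt_succ_of_le hx) _).trans ?_
    refine (mul_le_mul_right (hg _ hx x rfl) _).trans ?_
    rw [← ENNReal.ofReal_natCast, ← ENNReal.ofReal_mul (Nat.cast_nonneg _)]
    refine ENNReal.ofReal_le_ofReal ?_
    have h := hcard _ hx
    change T x / _ ≤ 1 + K * (m + 1) ^ 2 * (T x * _) at h
    set u := T x * 2 ^ (-(m * entropy D)) with hu
    have hu0 : 0 ≤ u := by positivity
    have hm0 : (0 : ℝ) ≤ m := Nat.cast_nonneg m
    change ((m + 1 : ℕ) : ℝ) * (1 + m * (T x / _)) ≤ _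
    push_cast
    have hm1 : (1 : ℝ) ≤ m + 1 := by linarith
    have h2 : (1 : ℝ) ≤ (m + 1) ^ 2 := one_le_pow₀ hm1
    have h3 : (1 : ℝ) ≤ (m + 1) ^ 3 := one_le_pow₀ hm1
    calc ((m : ℝ) + 1) * (1 + m * (T x / _))
        ≤ (m + 1) * (1 + m * (1 + K * (m + 1) ^ 2 * u)) := by gcongr
      _ ≤ (m + 1) * ((m + 1) ^ 3 + (m + 1) * ((m + 1) ^ 2 + K * (m + 1) ^ 2 * u)) := by
          gcongr; linarith
      _ = (m + 1) ^ 4 * (2 + K * u) := by ring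
      _ ≤ (m + 1) ^ 4 * ((2 + K) * (1 + u)) := by
          gcongr
          nlinarith [mul_nonneg hK.le hu0]
      _ = _ := by ring
  refine (optMoment_le hp hρ (fun _ => f) _ (fun x => by positivity) hbound).trans ?_
  refine ENNReal.ofReal_le_ofReal ?_
  calc ∑ x : Word m, iidLaw p x *
        ((2 + K) * (m + 1) ^ 4 * (1 + T x * 2 ^ (-(m * entropy D)))) ^ ρ
      = ((2 + K) * (m + 1) ^ 4) ^ ρ *
        ∑ x : Word m, iidLaw p x * (1 + T x * 2 ^ (-(m * entropy D))) ^ ρ := by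
        rw [Finset.mul_sum]
        refine Finset.sum_congr rfl fun x _ => ?_
        rw [Real.mul_rpow (by positivity) (by positivity)]
        ring
    _ ≤ ((2 + K) * (m + 1) ^ 4) ^ ρ * (2 ^ ρ * 2 *
        2 ^ max (m * (ρ * renyiEntropy (1 / (1 + ρ)) p) - ρ * (m * entropy D)) 0) := by
        gcongr
        exact sum_iidLaw_mul_one_add_rpow_le hp hρ _
    _ = _ := by
        rw [Real.mul_rpow (by positivity) (by positivity), Real.rpow_mul (by positivity)]
        norm_cast
        ring

/-! ### Random parity checks. -/

/-- Parity check matrices with `r` rows, as linear maps. -/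
abbrev ParityCheck (m r : ℕ) : Type := Word m →ₗ[ZMod 2] (Fin r → ZMod 2)

noncomputable instance (m r : ℕ) : Fintype (ParityCheck m r) :=
  haveI : Finite (ParityCheck m r) := DFunLike.finite _
  Fintype.ofFinite _

section Moments

variable {m r : ℕ}

open Classical in
/-- The parity checks that vanish on `U`. -/
noncomputable def vanishing (r : ℕ) (U : Submodule (ZMod 2) (Word m)) :
    Finset (ParityCheck m r) :=
  Finset.univ.filter fun H => U ≤ LinearMap.ker H

theorem mem_vanishing {U : Submodule (ZMod 2) (Word m)} {H : ParityCheck m r} :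
    H ∈ vanishing r U ↔ U ≤ LinearMap.ker H := by
  simp [vanishing]

theorem vanishing_bot : vanishing r (⊥ : Submodule (ZMod 2) (Word m)) = Finset.univ := by
  ext H
  simp [mem_vanishing]

theorem vanishing_sup_span (U : Submodule (ZMod 2) (Word m)) (z : Word m) :
    vanishing r (U ⊔ Submodule.span (ZMod 2) {z})
      = (vanishing r U).filter fun H => H z = 0 := by
  ext H
  rw [Finset.mem_filter, mem_vanishing, mem_vanishing, sup_le_iff,
    Submodule.span_singleton_le_iff_mem, LinearMap.mem_ker]

/-- A new vector is annihilated by a fraction `2 ^ (-r)` of the parity checks. -/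
theorem card_vanishing_sup_span {U : Submodule (ZMod 2) (Word m)} {z : Word m} (hz : z ∉ U) :
    (vanishing r (U ⊔ Submodule.span (ZMod 2) {z})).card * 2 ^ r = (vanishing r U).card := by
  -- Since f vanishes on U and f z = 1, adding f ⊗ v to a check that kills z prescribes the value v
  -- at z without affecting U; all 2^r values occur equally often.
  obtain ⟨f, hf, hU⟩ := Submodule.exists_le_ker_of_notMem hz
  have hf1 : f z = 1 := (bit_eq_one_iff _).2 hf
  have hE : Fintype.card (Fin r → ZMod 2) = 2 ^ r := by
    rw [Fintype.card_fun, ZMod.card, Fintype.card_fin]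
  rw [← hE, ← Finset.card_univ, ← Finset.card_product]
  refine Finset.card_bij (fun q _ => q.1 + f.smulRight q.2) ?_ ?_ ?_
  · intro q hq
    have hq1 := mem_vanishing.1 (Finset.mem_product.1 hq).1
    refine mem_vanishing.2 fun u hu => ?_
    have h1 : q.1 u = 0 := hq1 (Submodule.mem_sup_left hu)
    have h2 : f u = 0 := hU hu
    simp [h1, h2]
  · intro q hq q' hq' h
    have key : ∀ q ∈ vanishing r (U ⊔ Submodule.span (ZMod 2) {z}) ×ˢ
        (Finset.univ : Finset (Fin r → ZMod 2)), (q.1 + f.smulRight q.2) z = q.2 := by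
      intro q hq
      have hq1 := mem_vanishing.1 (Finset.mem_product.1 hq).1
      have h1 : q.1 z = 0 := hq1 (Submodule.mem_sup_right (Submodule.mem_span_singleton_self z))
      simp [h1, hf1]
    have h2 : q.2 = q'.2 := by rw [← key q hq, ← key q' hq', h]
    refine Prod.ext ?_ h2
    rw [h2] at h
    exact add_right_cancel h
  · intro H hH
    have hH' := mem_vanishing.1 hH
    refine ⟨(H - f.smulRight (H z), H z), ?_, by simp⟩
    refine Finset.mem_product.2 ⟨?_, Finset.mem_univ _⟩
    rw [vanishing_sup_span, Finset.mem_filter]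
    refine ⟨mem_vanishing.2 fun u hu => ?_, by simp [hf1]⟩
    have h1 : H u = 0 := hH' hu
    have h2 : f u = 0 := hU hu
    simp [h1, h2]

theorem card_sup_span_le (U : Submodule (ZMod 2) (Word m)) (z : Word m) :
    Nat.card (U ⊔ Submodule.span (ZMod 2) {z} : Submodule (ZMod 2) (Word m)) ≤ 2 * Nat.card U := by
  have hs : Function.Surjective (fun q : U × ZMod 2 =>
      (⟨q.1 + q.2 • z, Submodule.add_mem_sup q.1.2
        (Submodule.smul_mem _ _ (Submodule.mem_span_singleton_self z))⟩ :
        (U ⊔ Submodule.span (ZMod 2) {z} : Submodule (ZMod 2) (Word m)))) := by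
    rintro ⟨v, hv⟩
    obtain ⟨u, hu, w, hw, rfl⟩ := Submodule.mem_sup.1 hv
    obtain ⟨a, rfl⟩ := Submodule.mem_span_singleton.1 hw
    exact ⟨(⟨u, hu⟩, a), rfl⟩
  have := Nat.card_le_card_of_surjective _ hs
  rwa [Nat.card_prod, Nat.card_zmod, mul_comm] at this

/-- Moments of the number of elements of `A` in the kernel of a random parity check. -/
theorem sum_card_pow_le (A : Finset (Word m)) (n : ℕ) (U : Submodule (ZMod 2) (Word m)) :
    ∑ H ∈ vanishing r U, ((A.filter fun z => H z = 0).card : ℝ) ^ n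
      ≤ (vanishing r U).card * (Nat.card U * 2 ^ n + A.card / 2 ^ r) ^ n := by
  classical
  induction n generalizing U with
  | zero => simp
  | succ n ih =>
    set μ : ℝ := A.card / 2 ^ r with hμ
    have hμ0 : 0 ≤ μ := by positivity
    set B : ℝ := (Nat.card U * 2 ^ (n + 1) + μ) ^ n with hB
    have hB0 : 0 ≤ B := by positivity
    -- One factor of the power is expanded as a sum over z. For z ∈ U, at most |U| words, the
    -- condition on H is unchanged; each other z costs a factor 2^(-r) and at most doubles U.
    have hexpand : ∑ H ∈ vanishing r U, ((A.filter fun z => H z = 0).card : ℝ) ^ (n + 1)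
        = ∑ z ∈ A, ∑ H ∈ vanishing r (U ⊔ Submodule.span (ZMod 2) {z}),
            ((A.filter fun z => H z = 0).card : ℝ) ^ n := by
      simp_rw [vanishing_sup_span, Finset.sum_filter (s := vanishing r U)]
      rw [Finset.sum_comm]
      refine Finset.sum_congr rfl fun H _ => ?_
      rw [← Finset.sum_filter, Finset.sum_const, nsmul_eq_mul, pow_succ, mul_comm]
    rw [hexpand, ← Finset.sum_filter_add_sum_filter_not A fun z => z ∈ U]
    have hin : ∑ z ∈ A.filter (fun z => z ∈ U),
        ∑ H ∈ vanishing r (U ⊔ Submodule.span (ZMod 2) {z}),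
          ((A.filter fun z => H z = 0).card : ℝ) ^ n
        ≤ Nat.card U * ((vanishing r U).card * B) := by
      calc _ ≤ ∑ z ∈ A.filter (fun z => z ∈ U), (vanishing r U).card * B := by
            refine Finset.sum_le_sum fun z hz => ?_
            have hz' : Submodule.span (ZMod 2) {z} ≤ U :=
              (Submodule.span_singleton_le_iff_mem _ _).2 (Finset.mem_filter.1 hz).2
            rw [sup_eq_left.2 hz']
            refine (ih U).trans (mul_le_mul_of_nonneg_left ?_ (Nat.cast_nonneg _))
            refine pow_le_pow_left₀ (by positivity) (add_le_add_left
              (mul_le_mul_of_nonneg_left ?_ (Nat.cast_nonneg _)) _) n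
            exact pow_le_pow_right₀ (by norm_num) (by omega)
        _ ≤ _ := by
            rw [Finset.sum_const, nsmul_eq_mul]
            gcongr
            have h1 : (U : Set (Word m)).ncard = Nat.card U := rfl
            rw [← h1, ← Set.ncard_coe_finset]
            exact Set.ncard_le_ncard (fun z hz => (Finset.mem_filter.1 (Finset.mem_coe.1 hz)).2)
              (Set.toFinite _)
    have hout : ∑ z ∈ A.filter (fun z => z ∉ U),
        ∑ H ∈ vanishing r (U ⊔ Submodule.span (ZMod 2) {z}),
          ((A.filter fun z => H z = 0).card : ℝ) ^ n
        ≤ μ * ((vanishing r U).card * B) := by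
      calc _ ≤ ∑ z ∈ A.filter (fun z => z ∉ U), (vanishing r U).card / 2 ^ r * B := by
            refine Finset.sum_le_sum fun z hz => ?_
            have hc := card_vanishing_sup_span (r := r) (Finset.mem_filter.1 hz).2
            have hc' : ((vanishing r (U ⊔ Submodule.span (ZMod 2) {z})).card : ℝ)
                = (vanishing r U).card / 2 ^ r := by
              rw [eq_div_iff (by positivity)]
              exact_mod_cast hc
            refine (ih _).trans ?_
            rw [hc']
            refine mul_le_mul_of_nonneg_left (pow_le_pow_left₀ (by positivity) ?_ n) (by positivity)
            have := card_sup_span_le U z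
            have h2 : (Nat.card (U ⊔ Submodule.span (ZMod 2) {z} :
                Submodule (ZMod 2) (Word m)) : ℝ) ≤ 2 * Nat.card U := by exact_mod_cast this
            -- The factor 2^n in the induction statement absorbs the doubling of U.
            calc _ ≤ (2 * Nat.card U : ℝ) * 2 ^ n + μ := by gcongr
              _ = _ := by rw [pow_succ]; ring
        _ ≤ A.card * ((vanishing r U).card / 2 ^ r * B) := by
            rw [Finset.sum_const, nsmul_eq_mul]
            gcongr
            exact Finset.filter_subset _ _
        _ = _ := by rw [hμ]; ring
    refine (add_le_add hin hout).trans ?_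
    have h1 : (1 : ℝ) ≤ 2 ^ (n + 1) := one_le_pow₀ (by norm_num)
    calc _ = (vanishing r U).card * ((Nat.card U * 1 + μ) * B) := by ring
      _ ≤ (vanishing r U).card * ((Nat.card U * 2 ^ (n + 1) + μ) * B) := by gcongr
      _ = _ := by rw [hB, pow_succ (n := n)]; ring

/-- The `ρ`-th moment of the number of elements of `A` in the kernel of a random parity check. -/
theorem sum_card_rpow_le {ρ : ℝ} (hρ : 0 < ρ) (A : Finset (Word m)) :
    ∑ H : ParityCheck m r, ((A.filter fun z => H z = 0).card : ℝ) ^ ρ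
      ≤ Fintype.card (ParityCheck m r) *
        ((1 + 2 ^ (⌈ρ⌉₊ * ⌈ρ⌉₊)) * (1 + A.card / 2 ^ r : ℝ) ^ ρ) := by
  set n := ⌈ρ⌉₊ with hn
  have hρn : ρ ≤ n := Nat.le_ceil ρ
  set b : ℝ := 1 + A.card / 2 ^ r with hb
  have hb1 : 1 ≤ b := by rw [hb]; linarith [show (0 : ℝ) ≤ A.card / 2 ^ r by positivity]
  have hb0 : 0 < b := by linarith
  have hmom := sum_card_pow_le (r := r) A n ⊥
  rw [vanishing_bot, Finset.card_univ] at hmom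
  have hbot : Nat.card (⊥ : Submodule (ZMod 2) (Word m)) = 1 := Nat.card_unique
  rw [hbot, Nat.cast_one, one_mul] at hmom
  have h2n : (1 : ℝ) ≤ 2 ^ n := one_le_pow₀ (by norm_num)
  calc _ ≤ ∑ H : ParityCheck m r,
        b ^ ρ * (1 + ((A.filter fun z => H z = 0).card : ℝ) ^ n / b ^ n) := by
        refine Finset.sum_le_sum fun H _ => ?_
        set N : ℝ := ((A.filter fun z => H z = 0).card : ℝ) with hN
        have hN0 : 0 ≤ N := Nat.cast_nonneg _
        -- Interpolation to the integer n ≥ ρ after scaling by b; the n-th moment bound (2^n b)^n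
        -- then leaves the constant 2^(n n).
        have hq : (N / b) ^ ρ ≤ 1 + (N / b) ^ n := by
          rcases le_total (N / b) 1 with h | h
          · have h1 := Real.rpow_le_one (by positivity) h hρ.le
            have h2 : 0 ≤ (N / b) ^ n := by positivity
            linarith
          · have h1 := Real.rpow_le_rpow_of_exponent_le h hρn
            rw [Real.rpow_natCast] at h1
            linarith
        calc N ^ ρ = b ^ ρ * (N / b) ^ ρ := by
              rw [← Real.mul_rpow hb0.le (by positivity), mul_div_cancel₀ _ hb0.ne']
          _ ≤ b ^ ρ * (1 + (N / b) ^ n) := by gcongr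
          _ = _ := by rw [div_pow]
    _ = b ^ ρ * (Fintype.card (ParityCheck m r) +
          (∑ H : ParityCheck m r, ((A.filter fun z => H z = 0).card : ℝ) ^ n) / b ^ n) := by
        rw [← Finset.mul_sum, Finset.sum_add_distrib, Finset.sum_div]
        simp
    _ ≤ b ^ ρ * (Fintype.card (ParityCheck m r) +
          (Fintype.card (ParityCheck m r) * (2 ^ n * b) ^ n) / b ^ n) := by
        gcongr
        refine hmom.trans ?_
        gcongr
        rw [hb, mul_add, mul_one]
        gcongr
        exact le_mul_of_one_le_left (by positivity) h2n
    _ = _ := by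
        rw [mul_pow, ← pow_mul]
        field_simp

end Moments

/-- The nonnegative ratios F / b have total average at most 3, so at some index their sum, and hence
each of them, is at most 3. -/
theorem exists_le_three_mul {ι : Type*} [Fintype ι] [Nonempty ι] {F₁ F₂ F₃ : ι → ℝ}
    {b₁ b₂ b₃ : ℝ} (h₁ : ∀ i, 0 ≤ F₁ i) (h₂ : ∀ i, 0 ≤ F₂ i) (h₃ : ∀ i, 0 ≤ F₃ i)
    (hb₁ : 0 < b₁) (hb₂ : 0 < b₂) (hb₃ : 0 < b₃)
    (hs₁ : ∑ i, F₁ i ≤ Fintype.card ι * b₁) (hs₂ : ∑ i, F₂ i ≤ Fintype.card ι * b₂)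
    (hs₃ : ∑ i, F₃ i ≤ Fintype.card ι * b₃) :
    ∃ i, F₁ i ≤ 3 * b₁ ∧ F₂ i ≤ 3 * b₂ ∧ F₃ i ≤ 3 * b₃ := by
  obtain ⟨i, -, hi⟩ := Finset.exists_le_of_sum_le (s := (Finset.univ : Finset ι))
    (f := fun i => F₁ i / b₁ + F₂ i / b₂ + F₃ i / b₃) (g := fun _ => (3 : ℝ))
    Finset.univ_nonempty (by
      rw [Finset.sum_add_distrib, Finset.sum_add_distrib, ← Finset.sum_div, ← Finset.sum_div,
        ← Finset.sum_div, Finset.sum_const, Finset.card_univ, nsmul_eq_mul]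
      have e₁ := (div_le_iff₀ hb₁).2 hs₁
      have e₂ := (div_le_iff₀ hb₂).2 hs₂
      have e₃ := (div_le_iff₀ hb₃).2 hs₃
      linarith)
  have e₁ := div_nonneg (h₁ i) hb₁.le
  have e₂ := div_nonneg (h₂ i) hb₂.le
  have e₃ := div_nonneg (h₃ i) hb₃.le
  exact ⟨i, (div_le_iff₀ hb₁).1 (by linarith), (div_le_iff₀ hb₂).1 (by linarith),
    (div_le_iff₀ hb₃).1 (by linarith)⟩

theorem card_parityCheck_eq {m r : ℕ} {u v : Word m} (h : u ≠ v) :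
    ((Finset.univ.filter fun H : ParityCheck m r => H u = H v).card : ℝ)
      = Fintype.card (ParityCheck m r) / 2 ^ r := by
  have hz : u - v ∉ (⊥ : Submodule (ZMod 2) (Word m)) := by
    rw [Submodule.mem_bot]; exact sub_ne_zero.2 h
  have hc := card_vanishing_sup_span (r := r) hz
  rw [vanishing_sup_span, vanishing_bot, Finset.card_univ] at hc
  simp only [map_sub, sub_eq_zero] at hc
  rw [eq_div_iff (by positivity)]
  exact_mod_cast hc

/-- A parity check with a small kernel, few confusable errors of weight at most `R`, and cosets
that contain not too many words of a given weight. -/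
theorem exists_parityCheck {p D ρ : ℝ} (hp : 0 ≤ p ∧ p ≤ 1) (hD : 0 ≤ D ∧ D ≤ 1) (hρ : 0 < ρ)
    (m r : ℕ) {R : ℝ} (hR : 0 ≤ R) :
    ∃ H : ParityCheck m r,
      (Nat.card (LinearMap.ker H) : ℝ) ≤ 3 * (2 + 2 ^ m / 2 ^ r) ∧
      ∑ e : Word m with ((hammingNorm e : ℝ) ≤ R ∧
          ∃ e' : Word m, e' ≠ e ∧ hammingNorm e' ≤ hammingNorm e ∧ H e' = H e), iidLaw D e
        ≤ 3 * ({e : Word m | (hammingNorm e : ℝ) ≤ R}.ncard / 2 ^ r) ∧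
      ∑ x : Word m, iidLaw p x *
          ({z : Word m | hammingNorm z = hammingNorm x ∧ H z = H x}.ncard : ℝ) ^ ρ
        ≤ 3 * ((1 + 2 ^ (⌈ρ⌉₊ * ⌈ρ⌉₊)) * ∑ x : Word m, iidLaw p x *
          (1 + ({z : Word m | hammingNorm z = hammingNorm x}.ncard : ℝ) * 2 ^ (-(r : ℝ))) ^ ρ) := by
  classical
  have hpow : (2 : ℝ) ^ (-(r : ℝ)) = (2 ^ r)⁻¹ := by
    rw [Real.rpow_neg (by norm_num), Real.rpow_natCast]
  refine exists_le_three_mul (fun H => Nat.cast_nonneg _)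
    (fun H => Finset.sum_nonneg fun e _ => iidLaw_nonneg hD e)
    (fun H => Finset.sum_nonneg fun x _ =>
      mul_nonneg (iidLaw_nonneg hp x) (by positivity)) (by positivity) ?_ ?_ ?_ ?_ ?_
  · have hne : {e : Word m | (hammingNorm e : ℝ) ≤ R}.Nonempty := ⟨0, by simpa using hR⟩
    have := (Set.ncard_pos (Set.toFinite _)).2 hne
    positivity
  · refine mul_pos (by positivity) ?_
    calc (0 : ℝ) < ∑ x : Word m, iidLaw p x := by rw [sum_iidLaw]; exact one_pos
      _ ≤ _ := by
        refine Finset.sum_le_sum fun x _ => le_mul_of_one_le_right (iidLaw_nonneg hp x) ?_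
        refine Real.one_le_rpow ?_ hρ.le
        have : (0 : ℝ) ≤ ({z : Word m | hammingNorm z = hammingNorm x}.ncard : ℝ) * 2 ^ (-(r : ℝ)) := by
          positivity
        linarith
  -- The kernel size is the first moment for A the set of all words.
  · have h := sum_card_pow_le (r := r) (Finset.univ : Finset (Word m)) 1 ⊥
    rw [vanishing_bot, Finset.card_univ, Finset.card_univ, Fintype.card_fun, ZMod.card,
      Fintype.card_fin] at h
    have hbot : Nat.card (⊥ : Submodule (ZMod 2) (Word m)) = 1 := Nat.card_unique
    rw [hbot] at h
    simp only [pow_one, Nat.cast_one, one_mul, Nat.cast_pow, Nat.cast_ofNat] at h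
    refine le_trans (le_of_eq ?_) h
    refine Finset.sum_congr rfl fun H _ => ?_
    congr 1
    have : Nat.card (LinearMap.ker H) = ((LinearMap.ker H : Submodule (ZMod 2) (Word m)) :
      Set (Word m)).ncard := rfl
    rw [this, ← Set.ncard_coe_finset]
    congr 1
    ext z
    simp
  · have hcard : ({e : Word m | (hammingNorm e : ℝ) ≤ R}.ncard : ℝ)
        = (Finset.univ.filter fun e : Word m => (hammingNorm e : ℝ) ≤ R).card := by
      rw [Set.ncard_eq_toFinset_card']; simp
    set Bl := Finset.univ.filter fun e : Word m => (hammingNorm e : ℝ) ≤ R with hBl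
    -- Union bound over the competitors e', which lie in the same ball because they are not heavier
    -- than e.
    calc _ ≤ ∑ H : ParityCheck m r, ∑ e ∈ Bl, ∑ e' ∈ Bl.filter (fun e' => e' ≠ e),
          if H e' = H e then iidLaw D e else 0 := by
          refine Finset.sum_le_sum fun H _ => ?_
          rw [hBl, Finset.sum_filter, Finset.sum_filter]
          refine Finset.sum_le_sum fun e _ => ?_
          by_cases he : (hammingNorm e : ℝ) ≤ R
          swap
          · simp [he]
          rw [if_pos he]
          have hnn : ∀ e' ∈ (Finset.univ.filter fun e : Word m => (hammingNorm e : ℝ) ≤ R).filter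
              (fun e' => e' ≠ e), 0 ≤ (if H e' = H e then iidLaw D e else 0) := by
            intro e' _
            split_ifs
            · exact iidLaw_nonneg hD e
            · exact le_rfl
          split_ifs with hcond
          · obtain ⟨-, e', hne, hle, hH⟩ := hcond
            have hmem : e' ∈ (Finset.univ.filter fun e : Word m => (hammingNorm e : ℝ) ≤ R).filter
                (fun e' => e' ≠ e) := by
              simp only [Finset.mem_filter, Finset.mem_univ, true_and]
              exact ⟨le_trans (by exact_mod_cast hle) he, hne⟩
            refine le_trans (le_of_eq ?_) (Finset.single_le_sum hnn hmem)
            rw [if_pos hH]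
          · exact Finset.sum_nonneg hnn
      _ = ∑ e ∈ Bl, ∑ e' ∈ Bl.filter (fun e' => e' ≠ e),
          iidLaw D e * (Fintype.card (ParityCheck m r) / 2 ^ r) := by
          rw [Finset.sum_comm]
          refine Finset.sum_congr rfl fun e _ => ?_
          rw [Finset.sum_comm]
          refine Finset.sum_congr rfl fun e' he' => ?_
          rw [← Finset.sum_filter, Finset.sum_const, nsmul_eq_mul,
            card_parityCheck_eq (Finset.mem_filter.1 he').2, mul_comm]
      _ ≤ ∑ e ∈ Bl, iidLaw D e * (Bl.card * (Fintype.card (ParityCheck m r) / 2 ^ r)) := by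
          refine Finset.sum_le_sum fun e _ => ?_
          have := iidLaw_nonneg hD e
          rw [Finset.sum_const, nsmul_eq_mul]
          calc _ ≤ (Bl.card : ℝ) * (iidLaw D e * (Fintype.card (ParityCheck m r) / 2 ^ r)) := by
                gcongr
                exact Finset.filter_subset _ _
            _ = _ := by ring
      _ ≤ 1 * (Bl.card * (Fintype.card (ParityCheck m r) / 2 ^ r)) := by
          rw [← Finset.sum_mul]
          gcongr
          rw [← sum_iidLaw (m := m) D]
          exact Finset.sum_le_sum_of_subset_of_nonneg (Finset.subset_univ _)
            fun e _ _ => iidLaw_nonneg hD e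
      _ = _ := by rw [hcard]; ring
  · rw [Finset.sum_comm, Finset.mul_sum, Finset.mul_sum]
    refine Finset.sum_le_sum fun x _ => ?_
    -- Translating by x turns the coset of x into the kernel, so the kernel moment bound applies to
    -- the translated weight class.
    set A := Finset.univ.filter fun v : Word m => hammingNorm (x + v) = hammingNorm x with hA
    have hcard : ∀ q : Word m → Prop,
        {z : Word m | hammingNorm z = hammingNorm x ∧ q (z - x)}.ncard
          = (A.filter fun v => q v).card := by
      intro q
      rw [← Set.ncard_coe_finset]
      refine Set.ncard_congr (fun z _ => z - x) ?_ (fun _ _ _ _ h => sub_left_injective h) ?_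
      · intro z hz
        simpa [hA] using hz
      · intro v hv
        refine ⟨x + v, ?_, by simp⟩
        simpa [hA] using hv
    have hfib : ∀ H : ParityCheck m r,
        {z : Word m | hammingNorm z = hammingNorm x ∧ H z = H x}.ncard
          = (A.filter fun v => H v = 0).card := by
      intro H
      have h := hcard fun v => H v = 0
      simp only [map_sub, sub_eq_zero] at h
      convert h
    have hcardA : {z : Word m | hammingNorm z = hammingNorm x}.ncard = A.card := by
      have h := hcard fun _ => True
      simpa using h
    simp_rw [hfib]
    rw [hcardA, ← Finset.mul_sum, hpow]
    calc _ ≤ iidLaw p x * (Fintype.card (ParityCheck m r) *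
        ((1 + 2 ^ (⌈ρ⌉₊ * ⌈ρ⌉₊)) * (1 + A.card / 2 ^ r : ℝ) ^ ρ)) :=
          mul_le_mul_of_nonneg_left (sum_card_rpow_le hρ A) (iidLaw_nonneg hp x)
      _ = _ := by rw [div_eq_mul_inv]; ring

/-! ### From finite bounds to growth rates. -/

section Asymptotics

theorem tendsto_logb_div_atTop : Tendsto (fun m : ℕ => Real.logb 2 ((m : ℝ) + 2) / m) atTop (𝓝 0) := by
  have h := (Real.tendsto_pow_log_div_mul_add_atTop 1 (-2) 1 one_ne_zero).comp
    (tendsto_atTop_add_const_right atTop (2 : ℝ) (tendsto_natCast_atTop_atTop (R := ℝ)))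
  have h2 := h.div_const (Real.log 2)
  rw [zero_div] at h2
  refine h2.congr fun m => ?_
  simp only [Function.comp, Real.logb, pow_one, one_mul, add_neg_cancel_right]
  rw [div_right_comm]

theorem growthRate_nonneg {m : ℕ} {M : ℝ≥0∞} (h1 : 1 ≤ M) : 0 ≤ growthRate m M := by
  unfold growthRate
  rcases eq_or_ne M ∞ with rfl | htop
  · simp
  have : 1 ≤ M.toReal := by
    rw [← ENNReal.toReal_one]; exact ENNReal.toReal_mono htop h1
  exact mul_nonneg (by positivity) (Real.logb_nonneg (by norm_num) this)

/-- Finiteness matters: `toReal` sends ∞ to 0, so an infinite moment would have rate 0. -/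
theorem growthRate_mono {m : ℕ} {M M' : ℝ≥0∞} (h1 : 1 ≤ M) (h : M ≤ M') (htop : M' ≠ ∞) :
    growthRate m M ≤ growthRate m M' := by
  unfold growthRate
  have h2 : 0 < M.toReal := ENNReal.toReal_pos (one_pos.trans_le h1).ne' (ne_top_of_le_ne_top htop h)
  gcongr
  norm_num

/-- Upper bound on the growth rate from a bound up to polynomial factors. -/
theorem eventually_growthRate_le {M : ℕ → ℝ≥0∞} {s : ℕ → ℝ} {K κ a ρ h : ℝ} (hK : 0 < K)
    (hκ : 0 ≤ κ) (h1 : ∀ m, 1 ≤ M m)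
    (hM : ∀ m : ℕ, M m ≤ ENNReal.ofReal
      (K * (m + 1 : ℝ) ^ κ * 2 ^ max (m * a - ρ * s m) 0))
    (hs : Tendsto (fun m => s m / m) atTop (𝓝 h)) {ε : ℝ} (hε : 0 < ε) :
    ∀ᶠ m in atTop, growthRate m (M m) ≤ max (a - ρ * h) 0 + ε := by
  have hlim : Tendsto (fun m : ℕ => Real.logb 2 K / m + κ * (Real.logb 2 ((m : ℝ) + 2) / m)
      + max (a - ρ * (s m / m)) 0) atTop (𝓝 (0 + κ * 0 + max (a - ρ * h) 0)) :=
    ((tendsto_const_div_atTop_nhds_zero_nat _).add (tendsto_logb_div_atTop.const_mul κ)).add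
      ((tendsto_const_nhds.sub (hs.const_mul ρ)).max tendsto_const_nhds)
  have hev := hlim.eventually_lt_const
    (show 0 + κ * 0 + max (a - ρ * h) 0 < max (a - ρ * h) 0 + ε by linarith)
  filter_upwards [hev, eventually_gt_atTop 0] with m hm hm0
  refine le_trans ?_ hm.le
  have hm' : (0 : ℝ) < m := by exact_mod_cast hm0
  refine (growthRate_mono (h1 m) (hM m) ENNReal.ofReal_ne_top).trans ?_
  unfold growthRate
  rw [ENNReal.toReal_ofReal (by positivity), Real.logb_mul (by positivity) (by positivity),
    Real.logb_mul (by positivity) (by positivity), Real.logb_rpow (by norm_num) (by norm_num),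
    Real.logb_rpow_eq_mul_logb_of_pos (by positivity), mul_add, mul_add]
  have e1 : 1 / (m : ℝ) * max (m * a - ρ * s m) 0 = max (a - ρ * (s m / m)) 0 := by
    rw [mul_max_of_nonneg _ _ (by positivity), mul_zero]
    congr 1
    field_simp
  have e2 : Real.logb 2 ((m : ℝ) + 1) ≤ Real.logb 2 ((m : ℝ) + 2) :=
    Real.logb_le_logb_of_le (by norm_num) (by positivity) (by linarith)
  rw [e1]
  gcongr ?_ + ?_ + _
  · rw [one_div_mul_eq_div]
  · calc 1 / (m : ℝ) * (κ * Real.logb 2 ((m : ℝ) + 1))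
        ≤ 1 / (m : ℝ) * (κ * Real.logb 2 ((m : ℝ) + 2)) := by gcongr
      _ = _ := by ring

/-- Lower bound on the growth rate when each guess is successful for about `2 ^ (m h)` secrets. -/
theorem eventually_le_growthRate {M : ℕ → ℝ≥0∞} {N : ℕ → ℝ} {a ρ h : ℝ} (hρ : 0 < ρ)
    (h1 : ∀ m, 1 ≤ M m) (htop : ∀ m, M m ≠ ∞) (hN1 : ∀ m, 1 ≤ N m)
    (hM : ∀ m : ℕ, ENNReal.ofReal (2 ^ (m * a) / (N m * (m + 2)) ^ ρ) ≤ M m)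
    (hN : ∀ δ : ℝ, 0 < δ → ∀ᶠ m : ℕ in atTop, N m ≤ 2 ^ ((m : ℝ) * (h + δ)))
    {ε : ℝ} (hε : 0 < ε) :
    ∀ᶠ m in atTop, max (a - ρ * h) 0 - ε ≤ growthRate m (M m) := by
  have hlim := tendsto_logb_div_atTop.const_mul ρ
  rw [mul_zero] at hlim
  filter_upwards [hN (ε / (2 * ρ)) (by positivity),
    hlim.eventually_lt_const (show 0 < ε / 2 by positivity), eventually_gt_atTop 0] with m hNm hlog hm0
  have hnn := growthRate_nonneg (m := m) (h1 m)
  have hm' : (0 : ℝ) < m := by exact_mod_cast hm0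
  have hNpos : 0 < N m := by linarith [hN1 m]
  -- The rate is nonnegative, so only the first entry of the maximum needs work. Half of ε pays for
  -- N, half for the polynomial factor.
  suffices a - ρ * h - ε ≤ growthRate m (M m) by
    rcases le_total (a - ρ * h) 0 with hc | hc
    · rw [max_eq_right hc]; linarith
    · rw [max_eq_left hc]; exact this
  have hle : (2 : ℝ) ^ (m * a) / (N m * (m + 2)) ^ ρ ≤ (M m).toReal :=
    (ENNReal.ofReal_le_iff_le_toReal (htop m)).1 (hM m)
  have hlogN : Real.logb 2 (N m) ≤ m * (h + ε / (2 * ρ)) := by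
    rw [Real.logb_le_iff_le_rpow (by norm_num) hNpos]
    exact hNm
  have hlogM := Real.logb_le_logb_of_le (b := 2) (by norm_num) (by positivity) hle
  rw [Real.logb_div (by positivity) (by positivity), Real.logb_rpow (by norm_num) (by norm_num),
    Real.logb_rpow_eq_mul_logb_of_pos (by positivity),
    Real.logb_mul hNpos.ne' (by positivity)] at hlogM
  unfold growthRate
  rw [one_div_mul_eq_div, le_div_iff₀ hm']
  have e1 : ρ * Real.logb 2 ((m : ℝ) + 2) ≤ ε / 2 * m := by
    have := hlog.le
    rw [← mul_div_assoc, div_le_iff₀ hm'] at this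
    exact this
  have e2 : ρ * Real.logb 2 (N m) ≤ ρ * (m * (h + ε / (2 * ρ))) := by gcongr
  have e3 : ρ * (m * (h + ε / (2 * ρ))) = ρ * h * m + ε / 2 * m := by field_simp
  nlinarith

theorem tendsto_of_eventually_le_of_eventually_ge {u : ℕ → ℝ} {L : ℝ}
    (hle : ∀ ε > 0, ∀ᶠ m in atTop, u m ≤ L + ε) (hge : ∀ ε > 0, ∀ᶠ m in atTop, L - ε ≤ u m) :
    Tendsto u atTop (𝓝 L) := by
  refine tendsto_order.2 ⟨fun b hb => ?_, fun b hb => ?_⟩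
  · filter_upwards [hge ((L - b) / 2) (by linarith)] with m hm
    linarith
  · filter_upwards [hle ((b - L) / 2) (by linarith)] with m hm
    linarith

end Asymptotics

/-! ### Rates for the distortion game and for general helper data. -/

section Converse

variable {p D ρ : ℝ}

theorem self_mem_ball (hD : 0 ≤ D) {m : ℕ} (x : Word m) :
    x ∈ {y | (hammingDist x y : ℝ) ≤ m * D} := by
  simp only [Set.mem_ofPred_eq, hammingDist_self, Nat.cast_zero]
  positivity

theorem eventually_growthRate_distortionMoment_le (hp : 0 ≤ p ∧ p ≤ 1) (hD : 0 ≤ D ∧ D ≤ 1 / 2)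
    (hρ : 0 < ρ) {ε : ℝ} (hε : 0 < ε) :
    ∀ᶠ m in atTop, growthRate m (distortionMoment ρ p D m) ≤ exponent ρ D p + ε := by
  obtain ⟨K, hK, hM⟩ := exists_distortionMoment_le hp hD hρ
  refine eventually_growthRate_le hK (by positivity) (fun m => one_le_optMoment hp hρ) hM ?_ hε
  refine tendsto_const_nhds.congr' ?_
  filter_upwards [eventually_gt_atTop 0] with m hm
  have : (m : ℝ) ≠ 0 := by exact_mod_cast hm.ne'
  field_simp

theorem eventually_le_growthRate_distortionMoment (hp : 0 ≤ p ∧ p ≤ 1)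
    (hD : 0 ≤ D ∧ D ≤ 1 / 2) (hρ : 0 < ρ) {ε : ℝ} (hε : 0 < ε) :
    ∀ᶠ m in atTop, exponent ρ D p - ε ≤ growthRate m (distortionMoment ρ p D m) := by
  have hN1 : ∀ m : ℕ, (1 : ℝ) ≤ 2 ^ (m * entropy D) := fun m =>
    Real.one_le_rpow (by norm_num) (mul_nonneg (Nat.cast_nonneg m) (entropy_nonneg hD))
  refine eventually_le_growthRate hρ (fun m => one_le_optMoment hp hρ)
    (fun m => optMoment_ne_top hρ fun x => self_mem_ball hD.1 x) hN1
    (fun m => le_optMoment hp hρ (hN1 m) fun g k => ?_) (fun δ hδ => ?_) hε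
  · refine le_trans ?_ (ncard_ball_le (m := m) hD)
    have : {x : Word m | g () k ∈ {y | (hammingDist x y : ℝ) ≤ m * D}}.ncard
        ≤ {e : Word m | (hammingNorm e : ℝ) ≤ m * D}.ncard := by
      refine Set.ncard_le_ncard_of_injOn (fun x => -x + g () k) (fun x hx => ?_)
        (fun _ _ _ _ h => neg_injective (add_left_injective _ h)) (Set.toFinite _)
      simpa [hammingDist_eq_hammingNorm] using hx
    exact_mod_cast this
  · refine Eventually.of_forall fun m => ?_
    refine Real.rpow_le_rpow_of_exponent_le (by norm_num) ?_
    gcongr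
    linarith

/-- A guess within distance m D of the response is decoded to it, so a distortion strategy that
ignores the helper data still succeeds. -/
theorem moment_le_distortionMoment {m : ℕ} {W : Type*} (S : HelperData m W) (hρ : 0 < ρ)
    (hS : S.CorrectsBall D) : S.moment ρ p ≤ distortionMoment ρ p D m := by
  refine optMoment_mono hρ (fun _ => ()) (fun _ => rfl) fun x y hy => ?_
  have h := hS x (-x + y) (by
    have hy' : (hammingDist x y : ℝ) ≤ m * D := hy
    rwa [hammingDist_eq_hammingNorm] at hy')
  rwa [add_neg_cancel_left] at h

theorem eventually_le_growthRate_moment (hp : 0 ≤ p ∧ p ≤ 1) (hρ : 0 < ρ) {W : ℕ → Type}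
    (S : ∀ m, HelperData m (W m))
    (hS : ∀ δ : ℝ, 0 < δ → ∀ᶠ m : ℕ in atTop,
      ((S m).numClasses : ℝ) ≤ 2 ^ ((m : ℝ) * (entropy D + δ))) {ε : ℝ} (hε : 0 < ε) :
    ∀ᶠ m : ℕ in atTop, exponent ρ D p - ε ≤ growthRate m ((S m).moment ρ p) := by
  have hN1 : ∀ m : ℕ, (1 : ℝ) ≤ (S m).numClasses := fun m => by
    exact_mod_cast (Set.ncard_pos (Set.finite_range _)).2 (Set.range_nonempty (S m).sketch)
  refine eventually_le_growthRate (M := fun m => (S m).moment ρ p)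
    (N := fun m => ((S m).numClasses : ℝ)) hρ
    (fun m => one_le_optMoment (side := (S m).sketch) hp hρ)
    (fun m => optMoment_ne_top (side := (S m).sketch) hρ fun x => (S m).recover_self x) hN1
    (fun m => le_optMoment (side := (S m).sketch) hp hρ (hN1 m) fun g k => ?_) hS hε
  -- The helper data fixes the k-th guess and therefore the response it recovers: at most one
  -- success per class.
  have : {x : Word m | g ((S m).sketch x) k ∈
      {y | (S m).recover y ((S m).sketch x) = x}}.ncard ≤ (S m).numClasses := by
    refine Set.ncard_le_ncard_of_injOn (S m).sketch (fun x _ => Set.mem_range_self x) ?_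
      (Set.finite_range _)
    intro x hx x' hx' h
    have e1 : (S m).recover (g ((S m).sketch x) k) ((S m).sketch x) = x := hx
    have e2 : (S m).recover (g ((S m).sketch x') k) ((S m).sketch x') = x' := hx'
    rw [← e1, h, e2]
  exact_mod_cast this

end Converse

/-! ### Helper data from linear codes. -/

section Code

variable {p D ρ : ℝ} {m r : ℕ}

/-- Every linear code has a system of coset representatives of minimal weight. -/
theorem exists_leader (C : Submodule (ZMod 2) (Word m)) :
    ∃ leader : Word m ⧸ C → Word m, leader 0 = 0 ∧ (∀ w, Submodule.Quotient.mk (leader w) = w) ∧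
      ∀ e, hammingNorm (leader (Submodule.Quotient.mk e)) ≤ hammingNorm e := by
  have hex : ∀ w : Word m ⧸ C, ∃ z : Word m, Submodule.Quotient.mk z = w ∧
      ∀ e : Word m, Submodule.Quotient.mk e = w → hammingNorm z ≤ hammingNorm e := by
    intro w
    obtain ⟨z₀, hz₀⟩ := Submodule.Quotient.mk_surjective C w
    obtain ⟨z, hz, hmin⟩ := Set.exists_min_image {z : Word m | Submodule.Quotient.mk z = w}
      (fun z => hammingNorm z) (Set.toFinite _) ⟨z₀, hz₀⟩
    exact ⟨z, hz, hmin⟩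
  choose leader h1 h2 using hex
  refine ⟨leader, ?_, h1, fun e => h2 _ e rfl⟩
  have := h2 0 0 (Submodule.Quotient.mk_zero C)
  rw [hammingNorm_zero, Nat.le_zero, hammingNorm_eq_zero] at this
  exact this

theorem quotient_mk_ker_eq_iff (H : ParityCheck m r) (x y : Word m) :
    (Submodule.Quotient.mk x : Word m ⧸ LinearMap.ker H) = Submodule.Quotient.mk y ↔ H x = H y := by
  rw [Submodule.Quotient.eq, LinearMap.mem_ker, map_sub, sub_eq_zero]

/-- Success depends on the noise alone, which removes p from the reliability. -/
theorem ofCode_recover_eq_iff (C : Submodule (ZMod 2) (Word m)) (leader : Word m ⧸ C → Word m)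
    (h0 : leader 0 = 0) (x e : Word m) :
    (HelperData.ofCode C leader h0).recover (x + e) ((HelperData.ofCode C leader h0).sketch x) = x
      ↔ leader (Submodule.Quotient.mk e) = e := by
  have h : (Submodule.Quotient.mk (x + e) : Word m ⧸ C) - Submodule.Quotient.mk x
      = Submodule.Quotient.mk e := by
    rw [← Submodule.Quotient.mk_sub, add_sub_cancel_left]
  change x + e - leader ((Submodule.Quotient.mk (x + e) : Word m ⧸ C) - Submodule.Quotient.mk x) = x
    ↔ _
  rw [h, sub_eq_iff_eq_add]
  constructor
  · intro h; exact (add_left_cancel h).symm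
  · intro h; rw [h]

open Classical in
theorem reliability_ofCode (C : Submodule (ZMod 2) (Word m)) (leader : Word m ⧸ C → Word m)
    (h0 : leader 0 = 0) :
    (HelperData.ofCode C leader h0).reliability p D
      = ∑ e : Word m with leader (Submodule.Quotient.mk e) = e, iidLaw D e := by
  unfold HelperData.reliability
  simp_rw [ofCode_recover_eq_iff]
  rw [← one_mul (∑ e : Word m with leader (Submodule.Quotient.mk e) = e, iidLaw D e),
    ← sum_iidLaw (m := m) p, Finset.sum_mul]
  refine Finset.sum_congr rfl fun x _ => ?_
  rw [← Finset.sum_filter, Finset.mul_sum]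

theorem reliability_le_one (hD : 0 ≤ D ∧ D ≤ 1) (C : Submodule (ZMod 2) (Word m))
    (leader : Word m ⧸ C → Word m) (h0 : leader 0 = 0) :
    (HelperData.ofCode C leader h0).reliability p D ≤ 1 := by
  classical
  rw [reliability_ofCode, ← sum_iidLaw (m := m) D]
  exact Finset.sum_le_sum_of_subset_of_nonneg (Finset.subset_univ _)
    fun e _ _ => iidLaw_nonneg hD e

/-- Minimum weight decoding fails only for heavy errors and for errors that can be confused with
another one which is not heavier. -/
theorem le_reliability_ker (hD : 0 ≤ D ∧ D ≤ 1) (H : ParityCheck m r)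
    (leader : Word m ⧸ LinearMap.ker H → Word m) (h0 : leader 0 = 0)
    (hmk : ∀ w, Submodule.Quotient.mk (leader w) = w)
    (hmin : ∀ e, hammingNorm (leader (Submodule.Quotient.mk e)) ≤ hammingNorm e) (R : ℝ) :
    1 - ∑ e : Word m with R < hammingNorm e, iidLaw D e
        - ∑ e : Word m with ((hammingNorm e : ℝ) ≤ R ∧
          ∃ e' : Word m, e' ≠ e ∧ hammingNorm e' ≤ hammingNorm e ∧ H e' = H e), iidLaw D e
      ≤ (HelperData.ofCode (LinearMap.ker H) leader h0).reliability p D := by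
  classical
  rw [reliability_ofCode, ← sum_iidLaw (m := m) D]
  simp_rw [Finset.sum_filter]
  rw [← Finset.sum_sub_distrib, ← Finset.sum_sub_distrib]
  refine Finset.sum_le_sum fun e _ => ?_
  have hP := iidLaw_nonneg hD e
  by_cases h1 : leader (Submodule.Quotient.mk e) = e
  · rw [if_pos h1]
    split_ifs <;> linarith
  rw [if_neg h1]
  rcases lt_or_ge R (hammingNorm e) with h2 | h2
  · rw [if_pos h2]
    split_ifs <;> linarith
  · have h3 : (hammingNorm e : ℝ) ≤ R ∧
        ∃ e' : Word m, e' ≠ e ∧ hammingNorm e' ≤ hammingNorm e ∧ H e' = H e :=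
      ⟨h2, _, h1, hmin e, (quotient_mk_ker_eq_iff H _ _).1 (hmk _)⟩
    rw [if_pos h3, if_neg (not_lt.2 h2)]
    linarith

/-- Guessing the words of a coset, in parallel over all weights. -/
theorem moment_ker_le (hp : 0 ≤ p ∧ p ≤ 1) (hρ : 0 < ρ) (H : ParityCheck m r)
    (leader : Word m ⧸ LinearMap.ker H → Word m) (h0 : leader 0 = 0) :
    (HelperData.ofCode (LinearMap.ker H) leader h0).moment ρ p
      ≤ ENNReal.ofReal ((m + 1 : ℝ) ^ ρ * ∑ x : Word m, iidLaw p x *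
          ({z : Word m | hammingNorm z = hammingNorm x ∧ H z = H x}.ncard : ℝ) ^ ρ) := by
  classical
  set S := HelperData.ofCode (LinearMap.ker H) leader h0 with hS
  choose g hg using fun (w : Word m ⧸ LinearMap.ker H) (t : ℕ) => exists_enumeration
    (Finset.univ.filter fun z : Word m => hammingNorm z = t ∧ Submodule.Quotient.mk z = w)
  choose f hf using fun w => exists_interleave (M := m + 1) (g w)
  have hcount : ∀ x : Word m, guessCount (f (S.sketch x)) {y | S.recover y (S.sketch x) = x}
      ≤ ENNReal.ofReal ((m + 1 : ℝ) *
        ({z : Word m | hammingNorm z = hammingNorm x ∧ H z = H x}.ncard : ℝ)) := by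
    intro x
    refine (hf _ _ (Nat.lt_succ_of_le (hammingNorm_le x)) _).trans ?_
    -- It suffices that the list contains x itself, which is a successful guess by `recover_self`.
    have h := hg (S.sketch x) (hammingNorm x) {y | S.recover y (S.sketch x) = x} x
      (by simp [hS, HelperData.ofCode]) (S.recover_self x)
    refine (mul_le_mul_right h _).trans (le_of_eq ?_)
    have hc : (Finset.univ.filter fun z : Word m =>
        hammingNorm z = hammingNorm x ∧ Submodule.Quotient.mk z = S.sketch x).card
        = {z : Word m | hammingNorm z = hammingNorm x ∧ H z = H x}.ncard := by
      rw [← Set.ncard_coe_finset]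
      congr 1
      ext z
      have := quotient_mk_ker_eq_iff H z x
      simp only [Finset.coe_filter, Finset.mem_univ, true_and, Set.mem_ofPred_eq]
      exact and_congr_right fun _ => this
    rw [hc, ENNReal.ofReal_mul (by positivity), ENNReal.ofReal_natCast]
    congr 1
    rw [← Nat.cast_add_one, ENNReal.ofReal_natCast]
  refine (optMoment_le hp hρ f _ (fun x => by positivity) hcount).trans (le_of_eq ?_)
  rw [Finset.mul_sum]
  congr 1
  refine Finset.sum_congr rfl fun x _ => ?_
  rw [Real.mul_rpow (by positivity) (by positivity)]
  ring

theorem numClasses_ker_le (H : ParityCheck m r) (leader : Word m ⧸ LinearMap.ker H → Word m)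
    (h0 : leader 0 = 0) :
    (HelperData.ofCode (LinearMap.ker H) leader h0).numClasses ≤ 2 ^ r := by
  have h1 : (HelperData.ofCode (LinearMap.ker H) leader h0).numClasses
      ≤ Nat.card (Word m ⧸ LinearMap.ker H) := by
    rw [← Set.ncard_univ]
    exact Set.ncard_le_ncard (Set.subset_univ _) (Set.toFinite _)
  refine h1.trans ?_
  rw [Nat.card_congr H.quotKerEquivRange.toEquiv]
  have h2 : Nat.card (LinearMap.range H) ≤ Nat.card (Fin r → ZMod 2) :=
    Nat.card_le_card_of_injective _ Subtype.val_injective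
  refine h2.trans_eq ?_
  rw [Nat.card_eq_fintype_card, Fintype.card_fun, ZMod.card, Fintype.card_fin]

theorem le_finrank_ker (H : ParityCheck m r) :
    (m : ℝ) - r ≤ Module.finrank (ZMod 2) (LinearMap.ker H) := by
  have h1 := LinearMap.finrank_range_add_finrank_ker H
  have h2 := Submodule.finrank_le (LinearMap.range H)
  rw [Module.finrank_fin_fun] at h1 h2
  have h3 : (m : ℝ) = Module.finrank (ZMod 2) (LinearMap.range H)
    + Module.finrank (ZMod 2) (LinearMap.ker H) := by exact_mod_cast h1.symm
  have h4 : (Module.finrank (ZMod 2) (LinearMap.range H) : ℝ) ≤ r := by exact_mod_cast h2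
  linarith

/-- With a = 2^(max (m - r) 0) ≥ 1 one has 3 (2 + a) ≤ 9 a ≤ 2^4 a, whence the 4. -/
theorem finrank_ker_le {H : ParityCheck m r}
    (hH : (Nat.card (LinearMap.ker H) : ℝ) ≤ 3 * (2 + 2 ^ m / 2 ^ r)) :
    (Module.finrank (ZMod 2) (LinearMap.ker H) : ℝ) ≤ 4 + max ((m : ℝ) - r) 0 := by
  rw [Module.natCard_eq_pow_finrank (K := ZMod 2), Nat.card_zmod] at hH
  have h1 : (2 : ℝ) ^ m / 2 ^ r ≤ 2 ^ max ((m : ℝ) - r) 0 := by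
    rw [← Real.rpow_natCast, ← Real.rpow_natCast, ← Real.rpow_sub (by norm_num)]
    exact Real.rpow_le_rpow_of_exponent_le (by norm_num) (le_max_left _ _)
  have h2 : (1 : ℝ) ≤ 2 ^ max ((m : ℝ) - r) 0 := Real.one_le_rpow (by norm_num) (le_max_right _ _)
  rw [← Real.rpow_le_rpow_left_iff (x := 2) (by norm_num), Real.rpow_natCast,
    Real.rpow_add (by norm_num)]
  push_cast at hH
  norm_num at hH ⊢
  linarith

/-- Needed because the enlarged radius D + δ may exceed 1/2, where the trivial bound 2^m takes over.
-/
theorem ncard_ball_min_le (hD : 0 ≤ D) :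
    ({e : Word m | (hammingNorm e : ℝ) ≤ m * D}.ncard : ℝ) ≤ 2 ^ (m * entropy (min D (1 / 2))) := by
  rcases le_total D (1 / 2) with h | h
  · rw [min_eq_left h]
    exact ncard_ball_le ⟨hD, h⟩
  · have h1 : entropy (1 / 2) = 1 := by
      rw [entropy_eq_binEntropy, one_div, Real.binEntropy_two_inv,
        div_self (Real.log_pos (by norm_num)).ne']
    have h2 : {e : Word m | (hammingNorm e : ℝ) ≤ m * D}.ncard ≤ 2 ^ m := by
      refine (Set.ncard_le_ncard (Set.subset_univ _) (Set.toFinite _)).trans_eq ?_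
      rw [Set.ncard_univ, Nat.card_eq_fintype_card, Fintype.card_fun, ZMod.card, Fintype.card_fin]
    rw [min_eq_right h, h1, mul_one, Real.rpow_natCast]
    exact_mod_cast h2

end Code

/-! ### Choice of the codes and conclusion. -/

theorem tendsto_ceil_mul_div {c : ℕ → ℝ} {h : ℝ} (hc0 : ∀ m, 0 ≤ c m)
    (hc : Tendsto c atTop (𝓝 h)) :
    Tendsto (fun m : ℕ => (⌈m * c m⌉₊ : ℝ) / m) atTop (𝓝 h) := by
  have hup : Tendsto (fun m : ℕ => c m + 1 / (m : ℝ)) atTop (𝓝 h) := by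
    simpa using hc.add tendsto_one_div_atTop_nhds_zero_nat
  refine tendsto_of_tendsto_of_tendsto_of_le_of_le' hc hup ?_ ?_
  · filter_upwards [eventually_gt_atTop 0] with m hm
    have hm' : (0 : ℝ) < m := by exact_mod_cast hm
    rw [le_div_iff₀ hm', mul_comm]
    exact Nat.le_ceil _
  · filter_upwards [eventually_gt_atTop 0] with m hm
    have hm' : (0 : ℝ) < m := by exact_mod_cast hm
    rw [div_le_iff₀ hm', add_mul, one_div_mul_cancel hm'.ne', mul_comm (c m)]
    exact (Nat.ceil_lt_add_one (mul_nonneg hm'.le (hc0 m))).le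

/-- Linear codes of rate tending to `1 - H(D)` which correct the noise with probability tending to
`1`, and whose cosets, used as helper data, do not increase the guesswork exponent. -/
theorem exists_codes {p D ρ : ℝ} (hp : 0 ≤ p ∧ p ≤ 1) (hD : 0 ≤ D ∧ D ≤ 1 / 2) (hρ : 0 < ρ) :
    ∃ (C : ∀ m : ℕ, Submodule (ZMod 2) (Word m)) (leader : ∀ m : ℕ, Word m ⧸ C m → Word m)
      (h0 : ∀ m, leader m 0 = 0),
      (∀ m w, Submodule.Quotient.mk (leader m w) = w) ∧
      Tendsto (fun m : ℕ => (Module.finrank (ZMod 2) (C m) : ℝ) / m) atTop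
        (𝓝 (1 - entropy D)) ∧
      Tendsto (fun m : ℕ => (HelperData.ofCode (C m) (leader m) (h0 m)).reliability p D) atTop
        (𝓝 1) ∧
      Tendsto (fun m : ℕ => growthRate m
          ((HelperData.ofCode (C m) (leader m) (h0 m)).moment ρ p)) atTop
        (𝓝 (exponent ρ D p)) := by
  have hD1 : 0 ≤ D ∧ D ≤ 1 := ⟨hD.1, by linarith [hD.2]⟩
  -- δ tends to 0, so the rates are unaffected, while m δ² tends to infinity, so the noise has
  -- weight at most m (D + δ) with probability tending to 1.
  set δ : ℕ → ℝ := fun m => (m : ℝ) ^ (-(1 / 4) : ℝ) with hδ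
  have hδ0 : ∀ m, 0 ≤ δ m := fun m => by positivity
  have hδ1 : ∀ m, δ m ≤ 1 := by
    intro m
    rcases Nat.eq_zero_or_pos m with rfl | hm
    · simp only [hδ, Nat.cast_zero]
      rw [Real.zero_rpow (by norm_num)]
      exact zero_le_one
    · exact Real.rpow_le_one_of_one_le_of_nonpos (by exact_mod_cast hm) (by norm_num)
  have hδlim : Tendsto δ atTop (𝓝 0) :=
    (tendsto_rpow_neg_atTop (by norm_num)).comp tendsto_natCast_atTop_atTop
  have hmδ : Tendsto (fun m : ℕ => (m : ℝ) * δ m) atTop atTop := by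
    have h : Tendsto (fun m : ℕ => (m : ℝ) ^ (3 / 4 : ℝ)) atTop atTop :=
      (tendsto_rpow_atTop (by norm_num)).comp tendsto_natCast_atTop_atTop
    refine h.congr' ?_
    filter_upwards [eventually_gt_atTop 0] with m hm
    have hm' : (0 : ℝ) < m := by exact_mod_cast hm
    rw [hδ, ← Real.rpow_one_add' hm'.le (by norm_num)]
    norm_num
  have hmδ2 : Tendsto (fun m : ℕ => (m : ℝ) * δ m ^ 2 / 2) atTop atTop := by
    have h : Tendsto (fun m : ℕ => (m : ℝ) ^ (1 / 2 : ℝ)) atTop atTop :=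
      (tendsto_rpow_atTop (by norm_num)).comp tendsto_natCast_atTop_atTop
    refine (h.atTop_div_const (show (0 : ℝ) < 2 by norm_num)).congr' ?_
    filter_upwards [eventually_gt_atTop 0] with m hm
    have hm' : (0 : ℝ) < m := by exact_mod_cast hm
    simp only [hδ]
    rw [← Real.rpow_mul_natCast hm'.le, ← Real.rpow_one_add' hm'.le (by norm_num)]
    norm_num
  set D' : ℕ → ℝ := fun m => min (D + δ m) (1 / 2) with hD'
  have hD'lim : Tendsto (fun m => entropy (D' m) + δ m) atTop (𝓝 (entropy D)) := by
    have h1 : Tendsto D' atTop (𝓝 D) := by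
      have := (tendsto_const_nhds (x := D)).add hδlim |>.min (tendsto_const_nhds (x := (1 / 2 : ℝ)))
      rwa [add_zero, min_eq_left hD.2] at this
    simpa using ((continuous_entropy.tendsto D).comp h1).add hδlim
  have hent : ∀ m, 0 ≤ entropy (D' m) := fun m =>
    entropy_nonneg ⟨le_min (add_nonneg hD.1 (hδ0 m)) (by norm_num), min_le_right _ _⟩
  -- The extra m δ rows make 2^r exceed the bound 2^(m H(D')) on the ball volume by a factor at
  -- least 2^(m δ), so confusable errors become negligible.
  set r : ℕ → ℕ := fun m => ⌈m * (entropy (D' m) + δ m)⌉₊ with hr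
  have hrlim : Tendsto (fun m => (r m : ℝ) / m) atTop (𝓝 (entropy D)) :=
    tendsto_ceil_mul_div (fun m => add_nonneg (hent m) (hδ0 m)) hD'lim
  choose H hker herr hmom using fun m => exists_parityCheck hp hD1 hρ m (r m)
    (R := m * (D + δ m)) (mul_nonneg (Nat.cast_nonneg m) (add_nonneg hD.1 (hδ0 m)))
  choose leader h0 hmk hmin using fun m => exists_leader (LinearMap.ker (H m))
  refine ⟨fun m => LinearMap.ker (H m), leader, h0, hmk, ?_, ?_, ?_⟩
  · have hlo : Tendsto (fun m : ℕ => 1 - (r m : ℝ) / m) atTop (𝓝 (1 - entropy D)) :=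
      tendsto_const_nhds.sub hrlim
    have hup : Tendsto (fun m : ℕ => 4 / (m : ℝ) + max (1 - (r m : ℝ) / m) 0) atTop
        (𝓝 (1 - entropy D)) := by
      have := (tendsto_const_div_atTop_nhds_zero_nat (4 : ℝ)).add
        (hlo.max (tendsto_const_nhds (x := (0 : ℝ))))
      rwa [zero_add, max_eq_left (sub_nonneg.2 (entropy_le_one D))] at this
    refine tendsto_of_tendsto_of_tendsto_of_le_of_le' hlo hup ?_ ?_
    · filter_upwards [eventually_gt_atTop 0] with m hm
      have hm' : (0 : ℝ) < m := by exact_mod_cast hm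
      rw [le_div_iff₀ hm', sub_mul, div_mul_cancel₀ _ hm'.ne', one_mul]
      exact le_finrank_ker (H m)
    · filter_upwards [eventually_gt_atTop 0] with m hm
      have hm' : (0 : ℝ) < m := by exact_mod_cast hm
      rw [div_le_iff₀ hm', add_mul, max_mul_of_nonneg _ _ hm'.le, sub_mul,
        div_mul_cancel₀ _ hm'.ne', div_mul_cancel₀ _ hm'.ne', one_mul, zero_mul]
      exact finrank_ker_le (hker m)
  · have hlo : Tendsto (fun m : ℕ => 1 - Real.exp (-(m * δ m ^ 2 / 2))
        - 3 * Real.exp (-(m * δ m * Real.log 2))) atTop (𝓝 1) := by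
      have h1 : Tendsto (fun m : ℕ => Real.exp (-(m * δ m ^ 2 / 2))) atTop (𝓝 0) :=
        Real.tendsto_exp_neg_atTop_nhds_zero.comp hmδ2
      have h2 : Tendsto (fun m : ℕ => Real.exp (-(m * δ m * Real.log 2))) atTop (𝓝 0) :=
        Real.tendsto_exp_neg_atTop_nhds_zero.comp
          (hmδ.atTop_mul_const (Real.log_pos (by norm_num)))
      simpa using (tendsto_const_nhds (x := (1 : ℝ)).sub h1).sub (h2.const_mul 3)
    refine tendsto_of_tendsto_of_tendsto_of_le_of_le hlo tendsto_const_nhds (fun m => ?_)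
      (fun m => reliability_le_one hD1 _ _ _)
    refine le_trans ?_ (le_reliability_ker hD1 (H m) (leader m) (h0 m) (hmk m) (hmin m)
      (m * (D + δ m)))
    have e1 := sum_iidLaw_tail_le (m := m) hD ⟨hδ0 m, hδ1 m⟩
    have e2 : ({e : Word m | (hammingNorm e : ℝ) ≤ m * (D + δ m)}.ncard : ℝ) / 2 ^ r m
        ≤ Real.exp (-(m * δ m * Real.log 2)) := by
      rw [div_le_iff₀ (by positivity)]
      refine (ncard_ball_min_le (add_nonneg hD.1 (hδ0 m))).trans ?_
      have e3 : Real.exp (-(m * δ m * Real.log 2)) = 2 ^ (-(m * δ m)) := by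
        rw [Real.rpow_def_of_pos (by norm_num)]
        congr 1
        ring
      rw [e3, ← Real.rpow_natCast, ← Real.rpow_add (by norm_num)]
      refine Real.rpow_le_rpow_of_exponent_le (by norm_num) ?_
      have e4 : (m : ℝ) * (entropy (D' m) + δ m) ≤ r m := Nat.le_ceil _
      change (m : ℝ) * entropy (D' m) ≤ _
      linarith
    linarith [herr m]
  · refine tendsto_of_eventually_le_of_eventually_ge (fun ε hε => ?_) (fun ε hε => ?_)
    · refine eventually_growthRate_le (s := fun m => (r m : ℝ)) (κ := ρ)
        (K := 3 * ((1 + 2 ^ (⌈ρ⌉₊ * ⌈ρ⌉₊)) * (2 ^ ρ * 2)))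
        (M := fun m => (HelperData.ofCode (LinearMap.ker (H m)) (leader m) (h0 m)).moment ρ p)
        (by positivity) hρ.le
        (fun m => one_le_optMoment (side := (HelperData.ofCode _ (leader m) (h0 m)).sketch) hp hρ)
        (fun m => ?_) hrlim hε
      refine (moment_ker_le hp hρ (H m) (leader m) (h0 m)).trans (ENNReal.ofReal_le_ofReal ?_)
      calc _ ≤ (m + 1 : ℝ) ^ ρ * (3 * ((1 + 2 ^ (⌈ρ⌉₊ * ⌈ρ⌉₊)) * (2 ^ ρ * 2 *
            2 ^ max (m * (ρ * renyiEntropy (1 / (1 + ρ)) p) - ρ * r m) 0))) := by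
            refine mul_le_mul_of_nonneg_left ((hmom m).trans ?_) (by positivity)
            gcongr
            exact sum_iidLaw_mul_one_add_rpow_le hp hρ _
        _ = _ := by ring
    · refine eventually_le_growthRate_moment hp hρ
        (fun m => HelperData.ofCode (LinearMap.ker (H m)) (leader m) (h0 m)) (fun η hη => ?_) hε
      filter_upwards [hrlim.eventually_lt_const (show entropy D < entropy D + η by linarith),
        eventually_gt_atTop 0] with m hm hm0
      have hm' : (0 : ℝ) < m := by exact_mod_cast hm0
      rw [div_lt_iff₀ hm'] at hm
      calc ((HelperData.ofCode (LinearMap.ker (H m)) (leader m) (h0 m)).numClasses : ℝ)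
          ≤ 2 ^ r m := by exact_mod_cast numClasses_ker_le (H m) (leader m) (h0 m)
        _ = 2 ^ (r m : ℝ) := (Real.rpow_natCast _ _).symm
        _ ≤ _ := Real.rpow_le_rpow_of_exponent_le (by norm_num) (by linarith)

end NoisyPUF

theorem theorem1 (p D ρ : ℝ) (hp : 0 ≤ p ∧ p ≤ 1) (hD : 0 ≤ D ∧ D ≤ 1 / 2) (hρ : 0 < ρ) :
    -- guessing the original response up to Hamming distortion `m D`
    Tendsto (fun m : ℕ => NoisyPUF.growthRate m (NoisyPUF.distortionMoment ρ p D m)) atTop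
      (𝓝 (NoisyPUF.exponent ρ D p)) ∧
    -- upper bound on the guesswork for all helper data that correct up to `m D` errors
    (∀ (W : ℕ → Type) (S : ∀ m, NoisyPUF.HelperData m (W m)),
      (∀ m, (S m).CorrectsBall D) →
      ∀ ε : ℝ, 0 < ε → ∀ᶠ m : ℕ in atTop,
        NoisyPUF.growthRate m ((S m).moment ρ p) ≤ NoisyPUF.exponent ρ D p + ε) ∧
    -- lower bound on the guesswork for all helper data with about `2 ^ (m H(D))` classes
    (∀ (W : ℕ → Type) (S : ∀ m, NoisyPUF.HelperData m (W m)),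
      (∀ δ : ℝ, 0 < δ → ∀ᶠ m : ℕ in atTop,
        ((S m).numClasses : ℝ) ≤ 2 ^ ((m : ℝ) * (NoisyPUF.entropy D + δ))) →
      ∀ ε : ℝ, 0 < ε → ∀ᶠ m : ℕ in atTop,
        NoisyPUF.exponent ρ D p - ε ≤ NoisyPUF.growthRate m ((S m).moment ρ p)) ∧
    -- the exact rate, with the cosets of a capacity-achieving linear code as helper data
    (∃ (C : ∀ m : ℕ, Submodule (ZMod 2) (NoisyPUF.Word m))
       (leader : ∀ m : ℕ, NoisyPUF.Word m ⧸ C m → NoisyPUF.Word m)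
       (h0 : ∀ m, leader m 0 = 0),
      (∀ m w, Submodule.Quotient.mk (leader m w) = w) ∧
      Tendsto (fun m : ℕ => (Module.finrank (ZMod 2) (C m) : ℝ) / m) atTop
        (𝓝 (1 - NoisyPUF.entropy D)) ∧
      Tendsto (fun m : ℕ =>
          (NoisyPUF.HelperData.ofCode (C m) (leader m) (h0 m)).reliability p D) atTop (𝓝 1) ∧
      Tendsto (fun m : ℕ => NoisyPUF.growthRate m
          ((NoisyPUF.HelperData.ofCode (C m) (leader m) (h0 m)).moment ρ p)) atTop
        (𝓝 (NoisyPUF.exponent ρ D p))) := by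
  have hup : ∀ ε : ℝ, 0 < ε → ∀ᶠ m : ℕ in atTop,
      NoisyPUF.growthRate m (NoisyPUF.distortionMoment ρ p D m) ≤ NoisyPUF.exponent ρ D p + ε :=
    fun _ hε => NoisyPUF.eventually_growthRate_distortionMoment_le hp hD hρ hε
  refine ⟨NoisyPUF.tendsto_of_eventually_le_of_eventually_ge hup fun _ hε =>
    NoisyPUF.eventually_le_growthRate_distortionMoment hp hD hρ hε, fun W S hS ε hε => ?_,
    fun W S hS ε hε => NoisyPUF.eventually_le_growthRate_moment hp hρ S hS hε,
    NoisyPUF.exists_codes hp hD hρ⟩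
  -- Helper data correcting the ball is at most as hard to guess as the distortion game.
  filter_upwards [hup ε hε] with m hm
  refine le_trans ?_ hm
  exact NoisyPUF.growthRate_mono (NoisyPUF.one_le_optMoment hp hρ)
    (NoisyPUF.moment_le_distortionMoment (S m) hρ (hS m))
    (NoisyPUF.optMoment_ne_top hρ fun x => NoisyPUF.self_mem_ball hD.1 x)
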